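/- Let $n\ge 0$. For a partition $\lambda=(\lambda_1\ge\lambda_2\ge\dots\ge\lambda_{\ell(\lambda)}>0)$ of $n$ put $\lambda_j=0$ for $j>\ell(\lambda)$, and let $m_i(\lambda)$ be the number of parts equal to $i$. Let $\mathcal O(n)$ and $\mathcal D(n)$ be the sets of partitions of $n$ into odd parts and into distinct parts. **Odd runs.** A run of $\lambda$ is a maximal sequence $2m-1,2m-3,\dots,2m-2k+1$ ($1\le k\le m$) of consecutive odd positive integers each of which occurs in $\lambda$ with odd multiplicity. It is an odd run if $k$ is odd and $k<m$. Let $\ell_r(\lambda)$ be the number of odd runs, and $$\mathcal{ODS}(n)=\{\lambda\in\mathcal O(n)\mid m_i(\lambda)\le 1\ \text{for } 1\le i\le \ell(\lambda)+\ell_r(\lambda)-2\}.$$ **Doubles.** The double $\mu^D$ of a partition $\mu$ is obtained by replacing each odd part $p$ by the pair $\frac{p+1}2,\frac{p-1}2$ and each even part $p$ by the pair $\frac p2+1,\frac p2-1$. The partition $\mu$ is spin regular if the sequence $\mu^D$ is strictly decreasing (an entry $0$ can then occur only at the end, where it is dropped). Let $\mathcal{SR}(n)$ be the set of spin regular partitions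 of $n$ and $$\mathcal D_{\le 2}(n)=\{\nu\in\mathcal D(n)\mid \nu_{2j-1}-\nu_{2j}\in\{1,2\}\ \text{for } 0<2j\le\ell(\nu)+1\}.$$ **The map $\Phi:\mathcal O(n)\to\mathcal D(n)$.** Write $\lambda\in\mathcal O(n)$ uniquely as the union of the parts of $\alpha$, $\alpha$ and $\beta$, where $\beta$ has distinct parts. (1) From each run of $\beta$ split off pairs of consecutive terms, starting with the largest term; if one term $p$ is left over (the smallest of the run), replace it by the pair $\frac{p+1}2,\frac{p-1}2$. List these pairs in the order in which they arise from left to right in $\beta$. Then, as long as possible, replace two adjacent pairs $(a+1,a\mid 2b+1,2b-1)$ with $a\le 2b+1$ by $(2b+3,2b+1\mid a-1,a-2)$; for definiteness, treat the pairs from the last to the first, moving each of them to the right as far as possible. Let $\gamma^{(0)}$ be the resulting list of pairs (this is Bressoud's map on partitions into distinct odd parts). (2) For $i=1,\dots,\ell(\alpha)$, let $\gamma^{(i)}$ be obtained by inserting $p=\alpha_i$ into $\gamma=\gamma^{(i-1)}=(\gamma_1,\gamma_2\mid\gamma_3,\gamma_4\mid\dots)$. Insertion is defined recursively, where an empty $\gamma$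 has $\gamma_1=\gamma_2=0$: if $p=1$, replace $\gamma_1$ by $\gamma_1+2$; if $p>1$ and $p-1>\gamma_1$, the result is $(p+1,p-1\mid\gamma_1,\gamma_2\mid\dots)$; otherwise the result is $(\gamma_1+2,\gamma_2+2)$ followed by the result of inserting $p-2$ into $(\gamma_3,\gamma_4\mid\dots)$. Then $\Phi(\lambda)$ is $\gamma^{(\ell(\alpha))}$ with zero entries dropped. **Proposition.** The map $\Phi$ is a bijection $\mathcal O(n)\to\mathcal D(n)$, and it restricts to a bijection $\mathcal{ODS}(n)\to\mathcal D_{\le2}(n)$. Doubling $\mu\mapsto\mu^D$ is a bijection $\mathcal{SR}(n)\to\mathcal D_{\le 2}(n)$. Consequently, the number of spin regular partitions of $n$ equals the number of odd partitions $\lambda$ of $n$ which have no repeated part less than $\ell(\lambda)+\ell_r(\lambda)-1$. -/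

import Mathlib

namespace SpinRegular

/-- The parts of a partition as a non-increasing list. -/
def sortedParts (s : Multiset ℕ) : List ℕ := s.sort (· ≥ ·)

/-- The sum of all the entries of a list of pairs. -/
def pairSum (L : List (ℕ × ℕ)) : ℕ := (L.map fun q => q.1 + q.2).sum

/-- The entries of a list of pairs, read from left to right. -/
def flatten (L : List (ℕ × ℕ)) : List ℕ := L.flatMap fun q => [q.1, q.2]

theorem sum_flatten (L : List (ℕ × ℕ)) : (flatten L).sum = pairSum L := by
  induction L with
  | nil => rfl
  | cons q L ih => simp_all [flatten, pairSum, add_assoc]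

/-! ### Doubles and spin regular partitions -/

/-- The pair that replaces a part `p` in the double of a partition. -/
def doublePart (p : ℕ) : ℕ × ℕ :=
  if Even p then (p / 2 + 1, p / 2 - 1) else ((p + 1) / 2, (p - 1) / 2)

theorem doublePart_sum {p : ℕ} (hp : p ≠ 0) : (doublePart p).1 + (doublePart p).2 = p := by
  unfold doublePart
  split_ifs with h
  · obtain ⟨k, rfl⟩ := h
    dsimp only
    omega
  · obtain ⟨k, rfl⟩ := Nat.not_even_iff_odd.mp h
    dsimp only
    omega

/-- The double of a partition as a sequence. A part `1` or `2` gives a pair with second entry `0`,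
and this entry is kept here. -/
def doubleList (s : Multiset ℕ) : List ℕ := flatten ((sortedParts s).map doublePart)

theorem sum_doubleList {n : ℕ} (μ : n.Partition) : (doubleList μ.parts).sum = n := by
  have key : ∀ l : List ℕ, (∀ p ∈ l, p ≠ 0) → pairSum (l.map doublePart) = l.sum := by
    intro l
    induction l with
    | nil => intro; rfl
    | cons p l ih =>
      intro h
      have h1 := doublePart_sum (h p (by simp))
      have h2 := ih fun q hq => h q (by simp [hq])
      simp only [pairSum, List.map_cons, List.sum_cons] at h2 ⊢
      omega
  rw [doubleList, sum_flatten, key _ fun p hp => ?_]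
  · rw [← Multiset.sum_coe, sortedParts, Multiset.sort_eq, μ.parts_sum]
  · exact (μ.parts_pos ((Multiset.mem_sort _).mp hp)).ne'

/-- The double of a partition of `n`, as a partition of `n` (zero entries are dropped). -/
def double {n : ℕ} (μ : n.Partition) : n.Partition :=
  Nat.Partition.ofSums n (doubleList μ.parts) (by rw [Multiset.sum_coe, sum_doubleList])

/-- `μ` is spin regular if its double is strictly decreasing (so that an entry `0` can only occur
at the very end): the double is then, as it stands, a partition with distinct parts. -/
def spinRegular (n : ℕ) : Set n.Partition :=
  {μ | (doubleList μ.parts).Pairwise (· > ·)}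

/-- The `i`-th largest part (`i ≥ 1`), or `0` if there are fewer than `i` parts. -/
def part (s : Multiset ℕ) (i : ℕ) : ℕ := (sortedParts s).getD (i - 1) 0

/-- Partitions `ν` of `n` into distinct parts such that `ν_{2j-1} - ν_{2j}` is `1` or `2` whenever
`0 < 2j ≤ ℓ(ν) + 1`. -/
def distinctLeTwo (n : ℕ) : Set n.Partition :=
  {ν | ν ∈ Nat.Partition.distincts n ∧ ∀ j : ℕ, 0 < 2 * j → 2 * j ≤ ν.parts.card + 1 →
    part ν.parts (2 * j - 1) = part ν.parts (2 * j) + 1 ∨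
    part ν.parts (2 * j - 1) = part ν.parts (2 * j) + 2}

/-! ### Runs -/

/-- `2m-1, 2m-3, …, 2m-2k+1` is a run: a maximal sequence of consecutive (positive) odd integers,
each of which occurs with odd multiplicity. -/
def IsRun (s : Multiset ℕ) (m k : ℕ) : Prop :=
  1 ≤ k ∧ k ≤ m ∧ (∀ i < k, Odd (s.count (2 * (m - i) - 1))) ∧
  Even (s.count (2 * m + 1)) ∧ (k < m → Even (s.count (2 * (m - k) - 1)))

/-- The number of odd runs: those with an odd number `k` of terms, not containing `1`. -/
noncomputable def oddRuns (s : Multiset ℕ) : ℕ :=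
  {r : ℕ × ℕ | IsRun s r.1 r.2 ∧ Odd r.2 ∧ r.2 < r.1}.ncard

/-- Odd partitions `λ` of `n` with `m_i(λ) ≤ 1` for `1 ≤ i ≤ ℓ(λ) + ℓ_r(λ) - 2`. -/
def oddDistinctSmall (n : ℕ) : Set n.Partition :=
  {l | l ∈ Nat.Partition.odds n ∧
    ∀ i : ℕ, 1 ≤ i → i + 2 ≤ l.parts.card + oddRuns l.parts → l.parts.count i ≤ 1}

/-! ### Bressoud's bijection -/

/-- Pairing and doubling. In a strictly decreasing list of odd numbers, each run is cut from its
largest term on into pairs `(x, x - 2)`; if a term is left over it is the smallest one of its run,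
and it is replaced by its double. -/
def pairing : List ℕ → List (ℕ × ℕ)
  | [] => []
  | [x] => [doublePart x]
  | x :: y :: l => if x = y + 2 then (x, y) :: pairing l else doublePart x :: pairing (y :: l)

/-- Adjacent pairs `p = (a + 1, a)`, `q = (2b + 1, 2b - 1)` with `a ≤ 2b + 1` are out of order. The
condition `2 ≤ a` makes sure that `2` can be subtracted. -/
def OutOfOrder (p q : ℕ × ℕ) : Prop :=
  p.1 = p.2 + 1 ∧ q.1 = q.2 + 2 ∧ Odd q.2 ∧ p.2 ≤ q.1 ∧ 2 ≤ p.2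

instance (p q : ℕ × ℕ) : Decidable (OutOfOrder p q) := by
  unfold OutOfOrder
  infer_instance

/-- One pair interchange `(a+1, a | 2b+1, 2b-1) ↦ (2b+3, 2b+1 | a-1, a-2)` somewhere in a list. -/
inductive Interchange : List (ℕ × ℕ) → List (ℕ × ℕ) → Prop
  | swap (u v : List (ℕ × ℕ)) (p q : ℕ × ℕ) (h : OutOfOrder p q) :
      Interchange (u ++ p :: q :: v) (u ++ (q.1 + 2, q.2 + 2) :: (p.1 - 2, p.2 - 2) :: v)

/-- Move a pair to the right, by pair interchanges, as far as possible. -/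
def interchange (p : ℕ × ℕ) : List (ℕ × ℕ) → List (ℕ × ℕ)
  | [] => [p]
  | q :: L =>
    if OutOfOrder p q then (q.1 + 2, q.2 + 2) :: interchange (p.1 - 2, p.2 - 2) L else p :: q :: L

/-- Apply pair interchanges as many times as possible, treating the pairs from the last one to the
first one. -/
def interchangeAll : List (ℕ × ℕ) → List (ℕ × ℕ) := List.foldr interchange []

theorem Interchange.cons (q : ℕ × ℕ) {L M : List (ℕ × ℕ)}
    (h : Relation.ReflTransGen Interchange L M) :
    Relation.ReflTransGen Interchange (q :: L) (q :: M) := by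
  refine h.lift (fun K => q :: K) ?_
  rintro _ _ ⟨u, v, p, r, h⟩
  exact Interchange.swap (q :: u) v p r h

theorem interchange_steps (p : ℕ × ℕ) (L : List (ℕ × ℕ)) :
    Relation.ReflTransGen Interchange (p :: L) (interchange p L) := by
  induction L generalizing p with
  | nil => exact .refl
  | cons q L ih =>
    rw [interchange]
    split_ifs with h
    · exact Relation.ReflTransGen.head (Interchange.swap [] L p q h) (Interchange.cons _ (ih _))
    · exact .refl

theorem interchange_isChain (p : ℕ × ℕ) (L : List (ℕ × ℕ))
    (hL : L.IsChain fun p q => ¬ OutOfOrder p q) :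
    (interchange p L).IsChain fun p q => ¬ OutOfOrder p q := by
  induction L generalizing p with
  | nil => simp [interchange]
  | cons q L ih =>
    rw [interchange]
    split_ifs with h
    · refine (List.isChain_cons).mpr ⟨fun r _ hr => ?_, ih _ hL.tail⟩
      have h1 := hr.1
      have h2 := h.2.1
      dsimp only at h1
      omega
    · exact List.isChain_cons_cons.mpr ⟨h, hL⟩

/-- `interchangeAll L` arises from `L` by pair interchanges. -/
theorem interchangeAll_steps (L : List (ℕ × ℕ)) :
    Relation.ReflTransGen Interchange L (interchangeAll L) := by
  induction L with
  | nil => exact .refl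
  | cons p L ih => exact (Interchange.cons p ih).trans (interchange_steps p _)

/-- No pair interchange can be applied to `interchangeAll L`. -/
theorem interchangeAll_final (L M : List (ℕ × ℕ)) : ¬ Interchange (interchangeAll L) M := by
  have key : (interchangeAll L).IsChain fun p q => ¬ OutOfOrder p q := by
    induction L with
    | nil => simp [interchangeAll]
    | cons p L ih => exact interchange_isChain p _ ih
  generalize interchangeAll L = K at key
  rintro ⟨u, v, p, q, h⟩
  exact (List.isChain_cons_cons.mp (List.isChain_append.mp key).2.1).1 h

/-- Bressoud's map on a strictly decreasing list of odd numbers; the image is given as a list of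
pairs of successive parts. -/
def bressoud (l : List ℕ) : List (ℕ × ℕ) := interchangeAll (pairing l)

theorem pairSum_pairing (l : List ℕ) (hl : ∀ p ∈ l, p ≠ 0) : pairSum (pairing l) = l.sum := by
  fun_induction pairing l with
  | case1 => rfl
  | case2 x => simpa [pairSum] using doublePart_sum (hl x (by simp))
  | case3 y l ih =>
    have := ih fun p hp => hl p (by simp [hp])
    simp only [pairSum, List.map_cons, List.sum_cons] at this ⊢
    omega
  | case4 x y l h ih =>
    have h1 := ih fun p hp => hl p (List.mem_cons_of_mem _ hp)
    have h2 := doublePart_sum (hl x (by simp))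
    simp only [pairSum, List.map_cons, List.sum_cons] at h1 ⊢
    omega

theorem pairSum_interchange (p : ℕ × ℕ) (L : List (ℕ × ℕ)) :
    pairSum (interchange p L) = p.1 + p.2 + pairSum L := by
  induction L generalizing p with
  | nil => simp [interchange, pairSum]
  | cons q L ih =>
    rw [interchange]
    split_ifs with h
    · have h1 := ih (p.1 - 2, p.2 - 2)
      have h2 := h.1
      have h3 := h.2.2.2.2
      simp only [pairSum, List.map_cons, List.sum_cons] at h1 ⊢
      omega
    · simp [pairSum]

theorem pairSum_bressoud (l : List ℕ) (hl : ∀ p ∈ l, p ≠ 0) : pairSum (bressoud l) = l.sum := by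
  rw [← pairSum_pairing l hl, bressoud]
  induction pairing l with
  | nil => rfl
  | cons p L ih =>
    change pairSum (interchange p (interchangeAll L)) = _
    rw [pairSum_interchange, ih]
    simp [pairSum]

/-! ### The bijection from odd to distinct partitions -/

/-- Insertion of an odd pair `p, p` (with `p = 2a - 1`) into a partition, which is given as a list
of pairs `(γ₁, γ₂ | γ₃, γ₄ | …)`. If `p = 1` then `2` is added to `γ₁`. Otherwise the pair
`(p + 1, p - 1)` is put in front if `p - 1 > γ₁`; if not, it is interchanged with `(γ₁, γ₂)`, which
becomes `(γ₁ + 2, γ₂ + 2)`, while the moving pair becomes `(p - 1, p - 3)`, that is, it now stands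
for `p - 2, p - 2`, and one continues with the remaining pairs. (The value `p = 0` is never used.) -/
def insertPair : ℕ → List (ℕ × ℕ) → List (ℕ × ℕ)
  | 0, L => L
  | p + 1, [] => [(p + 2, p)]
  | 1, q :: L => (q.1 + 2, q.2) :: L
  | p + 2, q :: L =>
    if p + 1 > q.1 then (p + 3, p + 1) :: q :: L else (q.1 + 2, q.2 + 2) :: insertPair p L

theorem pairSum_insertPair (p : ℕ) (L : List (ℕ × ℕ)) :
    pairSum (insertPair p L) = 2 * p + pairSum L := by
  fun_induction insertPair p L <;> simp only [pairSum, List.map_cons, List.sum_cons, List.map_nil,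
    List.sum_nil] at * <;> omega

/-- The partition `β` in the unique decomposition `λ = α² ∘ β` with `β` having distinct parts. -/
def oddPart (s : Multiset ℕ) : Multiset ℕ := s.dedup.filter fun i => Odd (s.count i)

/-- The partition `α` in the unique decomposition `λ = α² ∘ β` with `β` having distinct parts. -/
def halfPart (s : Multiset ℕ) : Multiset ℕ :=
  s.dedup.bind fun i => Multiset.replicate (s.count i / 2) i

theorem halfPart_add_oddPart (s : Multiset ℕ) : halfPart s + halfPart s + oddPart s = s := by
  have hα : ∀ i, (halfPart s).count i = s.count i / 2 := by
    intro i
    have : halfPart s = ∑ j ∈ s.toFinset, Multiset.replicate (s.count j / 2) j := rfl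
    rw [this, Multiset.count_sum']
    simp only [Multiset.count_replicate]
    rw [Finset.sum_ite_eq' s.toFinset i]
    split_ifs with h
    · rfl
    · rw [Multiset.count_eq_zero_of_notMem (by simpa using h), Nat.zero_div]
  ext i
  rw [Multiset.count_add, Multiset.count_add, hα, oddPart]
  by_cases h : Odd (s.count i)
  · have hi : i ∈ s := Multiset.count_pos.mp h.pos
    rw [Multiset.count_filter_of_pos (p := fun i => Odd (s.count i)) h, Multiset.count_dedup, if_pos hi]
    obtain ⟨k, hk⟩ := h
    omega
  · rw [Multiset.count_filter_of_neg (p := fun i => Odd (s.count i)) h]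
    obtain ⟨k, hk⟩ := Nat.not_odd_iff_even.mp h
    omega

/-- The image of `λ = α² ∘ β` as a list of pairs: start with the image of `β` under Bressoud's map
and insert the pairs `α₁², α₂², …`, largest first. -/
def imagePairs (s : Multiset ℕ) : List (ℕ × ℕ) :=
  (sortedParts (halfPart s)).foldl (fun L p => insertPair p L) (bressoud (sortedParts (oddPart s)))

theorem sum_imagePairs {n : ℕ} (l : n.Partition) : (flatten (imagePairs l.parts)).sum = n := by
  have key : ∀ (t : List ℕ) (L : List (ℕ × ℕ)),
      pairSum (t.foldl (fun L p => insertPair p L) L) = 2 * t.sum + pairSum L := by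
    intro t
    induction t with
    | nil => simp
    | cons p t ih =>
      intro L
      rw [List.foldl_cons, ih, pairSum_insertPair, List.sum_cons]
      ring
  have hs : ∀ s : Multiset ℕ, (sortedParts s).sum = s.sum := by
    intro s
    rw [← Multiset.sum_coe, sortedParts, Multiset.sort_eq]
  rw [sum_flatten, imagePairs, key, pairSum_bressoud _ fun p hp => ?_, hs, hs]
  · have h := congrArg Multiset.sum (halfPart_add_oddPart l.parts)
    rw [Multiset.sum_add, Multiset.sum_add, l.parts_sum] at h
    omega
  · have h := (Multiset.mem_sort _).mp hp
    rw [oddPart, Multiset.mem_filter, Multiset.mem_dedup] at h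
    exact (l.parts_pos h.1).ne'

/-- The map `λ ↦ μ` from odd partitions to distinct partitions, which extends Bressoud's bijection.
Only its values on odd partitions matter. -/
def oddToDistinct {n : ℕ} (l : n.Partition) : n.Partition :=
  Nat.Partition.ofSums n (flatten (imagePairs l.parts)) (by rw [Multiset.sum_coe, sum_imagePairs])

end SpinRegular

namespace SpinRegular

/-! ### Strictly decreasing lists of pairs -/

/-! Everything is done on strictly decreasing lists of pairs. Such a list can contain `0` only as
its last entry, so dropping zeros loses nothing (`ofSums_parts_of_below`). On these lists doubling
is inverted by adding up each pair: a pair with difference `1` or `2` is determined by its sum.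

For the map from odd to distinct partitions only injectivity is proved; surjectivity then follows
from Euler's theorem that both sets have the same size.

Insertions can be undone because `k` is the largest number for which the result of inserting `2k +
1` is `Insertable` (`insertable_insertPair`), and insertion at a fixed `k` is injective. As sizes
are inserted in decreasing order, the last one is always visible, and one peels them off until a
`Primitive` list, which is insertable for every `k`, remains.

Bressoud's map is injective because `normOne` and `normTwo` are invariant under interchanges: they
record the sums that the two kinds of pairs would formally have if all pairs `(a + 1, a)` stood in
front. These two sequences determine the list before the interchanges, since the gaps of at least
`4` leave only one way to merge them (`Gapped.eq_of_norm_eq`).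

For the restriction, inserting `2k + 1` keeps all differences at most `2` exactly if they were so
before and there are at most `k` pairs. Thus the image of `λ = α² ∘ β` is good iff `N + ℓ(α) ≤ k +
1` for every inserted `2k + 1`, where `N` is the number of pairs in the image of `β`. Leftover terms
in the pairing of `β` are the smallest terms of runs of odd length, so `2N` is `ℓ(β) + ℓ_r(λ)`, plus
`1` if the term `1` is left over. As `2k + 2` is even, this extra `1` is harmless. -/

/-- The entries of the list of pairs are strictly decreasing and less than `b`. -/
def Below : ℕ → List (ℕ × ℕ) → Prop
  | _, [] => True
  | b, q :: L => q.1 < b ∧ q.2 < q.1 ∧ Below q.2 L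

theorem Below.mono {b c : ℕ} {L : List (ℕ × ℕ)} (h : Below b L) (hbc : b ≤ c) : Below c L := by
  cases L with
  | nil => trivial
  | cons q L => exact ⟨h.1.trans_le hbc, h.2⟩

theorem below_iff {b : ℕ} {L : List (ℕ × ℕ)} :
    Below b L ↔ (flatten L).Pairwise (· > ·) ∧ ∀ x ∈ flatten L, x < b := by
  induction L generalizing b with
  | nil => simp [Below, flatten]
  | cons q L ih =>
    have hf : flatten (q :: L) = q.1 :: q.2 :: flatten L := rfl
    rw [Below, ih, hf]
    simp only [List.pairwise_cons, List.mem_cons, forall_eq_or_imp]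
    constructor
    · rintro ⟨h1, h2, h3, h4⟩
      exact ⟨⟨⟨h2, fun x hx => (h4 x hx).trans h2⟩, h4, h3⟩, h1, h2.trans h1,
        fun x hx => ((h4 x hx).trans h2).trans h1⟩
    · rintro ⟨⟨⟨h2, -⟩, h4, h3⟩, h1, -⟩
      exact ⟨h1, h2, h3, h4⟩

theorem exists_below {L : List (ℕ × ℕ)} (h : (flatten L).Pairwise (· > ·)) : ∃ b, Below b L :=
  ⟨(flatten L).sum + 1, below_iff.mpr ⟨h, fun _ hx => Nat.lt_succ_of_le (List.le_sum_of_mem hx)⟩⟩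

theorem Below.two_mul_length_le {b : ℕ} {L : List (ℕ × ℕ)} (h : Below b L) :
    2 * L.length ≤ b := by
  induction L generalizing b with
  | nil => simp
  | cons q L ih =>
    have := ih h.2.2
    have := h.1
    have := h.2.1
    rw [List.length_cons]
    omega

/-- Cut a list into pairs, adding an entry `0` at the end if necessary. -/
def toPairs : List ℕ → List (ℕ × ℕ)
  | [] => []
  | [x] => [(x, 0)]
  | x :: y :: l => (x, y) :: toPairs l

theorem filter_flatten_toPairs (l : List ℕ) (hl : ∀ x ∈ l, x ≠ 0) :
    (flatten (toPairs l)).filter (· ≠ 0) = l := by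
  fun_induction toPairs l with
  | case1 => rfl
  | case2 x =>
    have := hl x (by simp)
    simp [flatten, this]
  | case3 x y l ih =>
    have hx := hl x (by simp)
    have hy := hl y (by simp)
    have := ih fun z hz => hl z (by simp [hz])
    have hf : flatten ((x, y) :: toPairs l) = x :: y :: flatten (toPairs l) := rfl
    rw [hf, List.filter_cons_of_pos (by simpa using hx), List.filter_cons_of_pos (by simpa using hy),
      this]

/-- A pair following an entry `0` would have to be negative, so a zero can only close the list,
where `toPairs` puts it back. -/
theorem toPairs_filter_flatten {b : ℕ} {L : List (ℕ × ℕ)} (h : Below b L) :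
    toPairs ((flatten L).filter (· ≠ 0)) = L := by
  induction L generalizing b with
  | nil => rfl
  | cons q L ih =>
    obtain ⟨x, y⟩ := q
    have hf : flatten ((x, y) :: L) = x :: y :: flatten L := rfl
    have hx : x ≠ 0 := (Nat.zero_le y).trans_lt h.2.1 |>.ne'
    rw [hf, List.filter_cons_of_pos (by simpa using hx)]
    by_cases hy : y = 0
    · have h3 := h.2.2
      subst hy
      cases L with
      | nil => simp [flatten, toPairs]
      | cons r L => exact absurd h3.1 (Nat.not_lt_zero _)
    · rw [List.filter_cons_of_pos (by simpa using hy), toPairs, ih h.2.2]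

theorem below_toPairs {b : ℕ} {l : List ℕ} (h : l.Pairwise (· > ·)) (h0 : ∀ x ∈ l, x ≠ 0)
    (hb : ∀ x ∈ l, x < b) : Below b (toPairs l) := by
  fun_induction toPairs l generalizing b with
  | case1 => trivial
  | case2 x => exact ⟨hb x (by simp), Nat.pos_of_ne_zero (h0 x (by simp)), trivial⟩
  | case3 x y l ih =>
    rw [List.pairwise_cons, List.pairwise_cons] at h
    exact ⟨hb x (by simp), h.1 y (by simp), ih h.2.2 (fun z hz => h0 z (by simp [hz])) h.2.1⟩

/-- The successive parts of a partition, in pairs. -/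
def pairsOf {n : ℕ} (ν : n.Partition) : List (ℕ × ℕ) := toPairs (sortedParts ν.parts)

theorem mem_sortedParts {s : Multiset ℕ} {x : ℕ} : x ∈ sortedParts s ↔ x ∈ s :=
  Multiset.mem_sort _

theorem coe_sortedParts (s : Multiset ℕ) : (sortedParts s : Multiset ℕ) = s :=
  Multiset.sort_eq _ _

theorem sortedParts_ne_zero {n : ℕ} (ν : n.Partition) : ∀ x ∈ sortedParts ν.parts, x ≠ 0 :=
  fun _ hx => (ν.parts_pos (mem_sortedParts.mp hx)).ne'

theorem sortedParts_pairwise (s : Multiset ℕ) : (sortedParts s).Pairwise (· ≥ ·) :=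
  Multiset.pairwise_sort _ _

theorem sortedParts_pairwise_gt {s : Multiset ℕ} (h : s.Nodup) :
    (sortedParts s).Pairwise (· > ·) := by
  have hn : (sortedParts s).Nodup := by
    rw [← Multiset.coe_nodup, coe_sortedParts]
    exact h
  exact ((sortedParts_pairwise s).and hn).imp fun ⟨h1, h2⟩ => lt_of_le_of_ne h1 h2.symm

theorem sortedParts_coe {l : List ℕ} (h : l.Pairwise (· ≥ ·)) :
    sortedParts (l : Multiset ℕ) = l := by
  refine List.Perm.eq_of_pairwise' (sortedParts_pairwise _) h ?_
  exact Multiset.coe_eq_coe.mp (coe_sortedParts _)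

theorem pairsOf_injective {n : ℕ} : Function.Injective (pairsOf (n := n)) := by
  intro μ ν h
  have := congrArg (fun L => (flatten L).filter (· ≠ 0)) h
  simp only [pairsOf] at this
  rw [filter_flatten_toPairs _ (sortedParts_ne_zero μ),
    filter_flatten_toPairs _ (sortedParts_ne_zero ν)] at this
  ext1
  rw [← coe_sortedParts μ.parts, this, coe_sortedParts]

theorem mem_distincts {n : ℕ} {ν : n.Partition} :
    ν ∈ Nat.Partition.distincts n ↔ ν.parts.Nodup := by
  simp [Nat.Partition.distincts]

theorem below_pairsOf {n : ℕ} {ν : n.Partition} (h : ν ∈ Nat.Partition.distincts n) :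
    Below (n + 1) (pairsOf ν) := by
  refine below_toPairs (sortedParts_pairwise_gt (mem_distincts.mp h)) (sortedParts_ne_zero ν) ?_
  intro x hx
  have := Multiset.le_sum_of_mem (mem_sortedParts.mp hx)
  rw [ν.parts_sum] at this
  omega

theorem ofSums_parts_of_below {n b : ℕ} {L : List (ℕ × ℕ)} (h : Below b L)
    (hs : (flatten L : Multiset ℕ).sum = n) :
    Nat.Partition.ofSums n (flatten L) hs ∈ Nat.Partition.distincts n ∧
      pairsOf (Nat.Partition.ofSums n (flatten L) hs) = L := by
  have hp := (below_iff.mp h).1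
  have hq := hp.filter (· ≠ 0)
  have he : (Nat.Partition.ofSums n (flatten L) hs).parts =
      (((flatten L).filter (· ≠ 0) : List ℕ) : Multiset ℕ) := by
    simp [Nat.Partition.ofSums]
  constructor
  · rw [mem_distincts, he, Multiset.coe_nodup]
    exact hq.imp fun h => ne_of_gt h
  · rw [pairsOf, he, sortedParts_coe (hq.imp fun h => le_of_lt h), toPairs_filter_flatten h]

/-- The default value of `getD` agrees with the `0` by which `toPairs` completes an odd number of
entries, so an unpaired last part needs no separate condition. -/
theorem forall_getD_toPairs (l : List ℕ) (P : ℕ → ℕ → Prop) :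
    (∀ j, 2 * j < l.length → P (l.getD (2 * j) 0) (l.getD (2 * j + 1) 0)) ↔
      ∀ q ∈ toPairs l, P q.1 q.2 := by
  fun_induction toPairs l with
  | case1 => simp
  | case2 x =>
    simp only [List.length_singleton, List.mem_singleton, forall_eq]
    constructor
    · intro h
      exact h 0 (by simp)
    · intro h j hj
      obtain rfl : j = 0 := by omega
      exact h
  | case3 x y l ih =>
    rw [List.forall_mem_cons, ← ih]
    constructor
    · intro h
      refine ⟨h 0 (by simp), fun j hj => ?_⟩
      have := h (j + 1) (by simp only [List.length_cons]; omega)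
      simpa [mul_add] using this
    · rintro ⟨h0, h⟩ (_ | j) hj
      · exact h0
      · have := h j (by simp only [List.length_cons] at hj; omega)
        simpa [mul_add] using this

theorem mem_distinctLeTwo {n : ℕ} {ν : n.Partition} :
    ν ∈ distinctLeTwo n ↔ ν ∈ Nat.Partition.distincts n ∧
      ∀ q ∈ pairsOf ν, q.1 = q.2 + 1 ∨ q.1 = q.2 + 2 := by
  refine and_congr_right fun _ => ?_
  rw [pairsOf, ← forall_getD_toPairs _ fun x y => x = y + 1 ∨ x = y + 2]
  have hc : (sortedParts ν.parts).length = ν.parts.card := by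
    rw [← Multiset.coe_card, coe_sortedParts]
  rw [hc]
  constructor
  · intro h j hj
    exact h (j + 1) (by omega) (by omega)
  · rintro h (_ | j) h0 hj
    · omega
    · exact h j (by omega)

/-! ### Doubling -/

theorem doublePart_snd_lt {p : ℕ} (hp : p ≠ 0) :
    (doublePart p).1 = (doublePart p).2 + 1 ∨ (doublePart p).1 = (doublePart p).2 + 2 := by
  unfold doublePart
  split_ifs with h
  · obtain ⟨k, rfl⟩ := h
    dsimp only
    omega
  · obtain ⟨k, rfl⟩ := Nat.not_even_iff_odd.mp h
    dsimp only
    omega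

theorem doublePart_add {q : ℕ × ℕ} (h : q.1 = q.2 + 1 ∨ q.1 = q.2 + 2) :
    doublePart (q.1 + q.2) = q := by
  obtain ⟨x, y⟩ := q
  dsimp only at h ⊢
  unfold doublePart
  rcases h with rfl | rfl
  · rw [if_neg (by rw [Nat.not_even_iff_odd]; exact ⟨y, by ring⟩)]
    ext <;> dsimp only <;> omega
  · rw [if_pos ⟨y + 1, by ring⟩]
    ext <;> dsimp only <;> omega

theorem pairsOf_double {n : ℕ} {μ : n.Partition} (h : μ ∈ spinRegular n) :
    double μ ∈ Nat.Partition.distincts n ∧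
      pairsOf (double μ) = (sortedParts μ.parts).map doublePart := by
  obtain ⟨b, hb⟩ := exists_below (L := (sortedParts μ.parts).map doublePart) h
  exact ofSums_parts_of_below hb _

/-- Guarantees that sorting the sums of the pairs does not permute them. -/
theorem Below.pairwise_add {b : ℕ} {L : List (ℕ × ℕ)} (h : Below b L) :
    (L.map fun q => q.1 + q.2).Pairwise (· ≥ ·) ∧ ∀ q ∈ L, q.1 < b ∧ q.2 < b := by
  induction L generalizing b with
  | nil => simp
  | cons q L ih =>
    obtain ⟨h1, h2, h3⟩ := h
    obtain ⟨i1, i2⟩ := ih h3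
    refine ⟨?_, ?_⟩
    · rw [List.map_cons, List.pairwise_cons]
      refine ⟨?_, i1⟩
      simp only [List.mem_map]
      rintro _ ⟨r, hr, rfl⟩
      have := i2 r hr
      omega
    · rw [List.forall_mem_cons]
      refine ⟨by omega, fun r hr => ?_⟩
      have := i2 r hr
      omega

theorem bijOn_double (n : ℕ) :
    Set.BijOn (double (n := n)) (spinRegular n) (distinctLeTwo n) := by
  have hsum : ∀ μ : n.Partition,
      ((sortedParts μ.parts).map doublePart).map (fun q => q.1 + q.2) = sortedParts μ.parts := by
    intro μ
    rw [List.map_map]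
    conv_rhs => rw [← List.map_id (sortedParts μ.parts)]
    exact List.map_congr_left fun p hp => doublePart_sum (sortedParts_ne_zero μ p hp)
  refine ⟨?_, ?_, ?_⟩
  · intro μ hμ
    obtain ⟨h1, h2⟩ := pairsOf_double hμ
    refine mem_distinctLeTwo.mpr ⟨h1, ?_⟩
    rw [h2]
    simp only [List.mem_map]
    rintro _ ⟨p, hp, rfl⟩
    exact doublePart_snd_lt (sortedParts_ne_zero μ p hp)
  · intro μ hμ ν hν h
    have h1 : (sortedParts μ.parts).map doublePart = (sortedParts ν.parts).map doublePart := by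
      rw [← (pairsOf_double hμ).2, h, (pairsOf_double hν).2]
    ext1
    rw [← coe_sortedParts μ.parts, ← hsum μ, h1, hsum ν, coe_sortedParts]
  · intro ν hν
    obtain ⟨hd, hν⟩ := mem_distinctLeTwo.mp hν
    have hb := below_pairsOf hd
    set L := pairsOf ν with hL
    have hfs : (flatten L).sum = n := by
      have h1 : ∀ l : List ℕ, (flatten (toPairs l)).sum = l.sum := by
        intro l
        fun_induction toPairs l with
        | case1 => rfl
        | case2 x => simp [flatten]
        | case3 x y l ih => simp_all [flatten]
      rw [hL, pairsOf, h1, ← Multiset.sum_coe, coe_sortedParts, ν.parts_sum]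
    -- The preimage under doubling: every pair is replaced by its sum.
    let μ : n.Partition :=
      { parts := ((L.map fun q => q.1 + q.2 : List ℕ) : Multiset ℕ)
        parts_pos := by
          intro i hi
          rw [Multiset.mem_coe, List.mem_map] at hi
          obtain ⟨q, hq, rfl⟩ := hi
          have := hν q hq
          omega
        parts_sum := by
          rw [Multiset.sum_coe, ← hfs, sum_flatten, pairSum] }
    have hμ : (sortedParts μ.parts).map doublePart = L := by
      change (sortedParts ((L.map fun q => q.1 + q.2 : List ℕ) : Multiset ℕ)).map doublePart = L
      rw [sortedParts_coe hb.pairwise_add.1, List.map_map]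
      conv_rhs => rw [← List.map_id L]
      exact List.map_congr_left fun q hq => doublePart_add (hν q hq)
    have hs : μ ∈ spinRegular n := by
      change (flatten ((sortedParts μ.parts).map doublePart)).Pairwise (· > ·)
      rw [hμ]
      exact (below_iff.mp hb).1
    exact ⟨μ, hs, pairsOf_injective ((pairsOf_double hs).2.trans hμ)⟩

/-! ### Insertion -/

/-- The pair at position `i` (from `0`) has difference at most `2` if `i < k`, and if it is of the
form `(2c + 2, 2c)` then `k ≤ c + i`. -/
def Insertable : ℕ → List (ℕ × ℕ) → Prop
  | _, [] => True
  | k, q :: L => (1 ≤ k → q.1 ≤ q.2 + 2) ∧ (q.1 = q.2 + 2 → Even q.2 → 2 * k ≤ q.2 ∨ k = 0) ∧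
      Insertable (k - 1) L

theorem Insertable.mono {k m : ℕ} {L : List (ℕ × ℕ)} (h : Insertable k L) (hm : m ≤ k) :
    Insertable m L := by
  induction L generalizing k m with
  | nil => trivial
  | cons q L ih =>
    obtain ⟨h1, h2, h3⟩ := h
    refine ⟨fun hm' => h1 (hm'.trans hm), fun e1 e2 => ?_, ih h3 (by omega)⟩
    have := h2 e1 e2
    omega

theorem insertPair_odd_nil (k : ℕ) : insertPair (2 * k + 1) [] = [(2 * k + 2, 2 * k)] := rfl

theorem insertPair_one_cons (q : ℕ × ℕ) (L : List (ℕ × ℕ)) :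
    insertPair (2 * 0 + 1) (q :: L) = (q.1 + 2, q.2) :: L := rfl

theorem insertPair_odd_cons (k : ℕ) (q : ℕ × ℕ) (L : List (ℕ × ℕ)) :
    insertPair (2 * (k + 1) + 1) (q :: L) =
      if 2 * (k + 1) > q.1 then (2 * (k + 1) + 2, 2 * (k + 1)) :: q :: L
      else (q.1 + 2, q.2 + 2) :: insertPair (2 * k + 1) L := rfl

/-- The danger is that, after passing `q`, the moving pair is not small enough to stand behind it.
`Insertable` excludes the one pair for which this happens. -/
theorem below_insertPair {k b : ℕ} {L : List (ℕ × ℕ)} (hL : Below b L) (hk : Insertable k L)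
    (hb : 2 * k < b) : Below (b + 2) (insertPair (2 * k + 1) L) := by
  induction L generalizing k b with
  | nil =>
    rw [insertPair_odd_nil]
    exact ⟨by dsimp only; omega, by dsimp only; omega, trivial⟩
  | cons q L ih =>
    obtain ⟨h1, h2, h3⟩ := hL
    obtain ⟨k1, k2, k3⟩ := hk
    cases k with
    | zero =>
      rw [insertPair_one_cons]
      exact ⟨by dsimp only; omega, by dsimp only; omega, h3⟩
    | succ k =>
      rw [insertPair_odd_cons]
      split_ifs with hc
      · exact ⟨by dsimp only; omega, by dsimp only; omega, hc, h2, h3⟩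
      · refine ⟨by dsimp only; omega, by dsimp only; omega, ih h3 k3 ?_⟩
        have := k1 (by omega)
        -- Since `2k + 2 ≤ q.1 ≤ q.2 + 2`, failure means `q = (2k + 2, 2k)`.
        by_contra hlt
        have := k2 (by omega) ⟨k, by omega⟩
        omega

/-- The resting place of the moving pair is the witness against `k + 1`: at position `i` it has
become `(2c + 2, 2c)` with `c + i = k`, or it has been absorbed as a `2` at position `k`, giving a
difference above `2`. Pairs that are passed gain `1` in `c`, and pairs behind the new one move one
position to the right; neither hurts. -/
theorem insertable_insertPair {k b : ℕ} {L : List (ℕ × ℕ)} (hL : Below b L)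
    (hk : Insertable k L) :
    Insertable k (insertPair (2 * k + 1) L) ∧ ¬ Insertable (k + 1) (insertPair (2 * k + 1) L) := by
  induction L generalizing k b with
  | nil =>
    rw [insertPair_odd_nil]
    refine ⟨⟨fun _ => le_rfl, fun _ _ => Or.inl le_rfl, trivial⟩, fun h => ?_⟩
    have := h.2.1 rfl (even_two_mul k)
    dsimp only at this
    omega
  | cons q L ih =>
    obtain ⟨h1, h2, h3⟩ := hL
    cases k with
    | zero =>
      rw [insertPair_one_cons]
      refine ⟨⟨by omega, fun _ _ => Or.inr rfl, hk.2.2⟩, fun h => ?_⟩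
      have := h.1 (by omega)
      dsimp only at this
      omega
    | succ k =>
      rw [insertPair_odd_cons]
      split_ifs with hc
      · refine ⟨⟨fun _ => le_rfl, fun _ _ => Or.inl le_rfl, hk.mono (by omega)⟩, fun h => ?_⟩
        have := h.2.1 rfl (even_two_mul (k + 1))
        dsimp only at this
        omega
      · obtain ⟨k1, k2, k3⟩ := hk
        obtain ⟨i1, i2⟩ := ih h3 k3
        refine ⟨⟨fun h => ?_, fun e1 e2 => ?_, i1⟩, fun h => i2 h.2.2⟩
        · have := k1 h
          dsimp only
          omega
        · have := k2 (by dsimp only at e1; omega) (by simpa [Nat.even_add] using e2)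
          dsimp only
          omega

/-- The head of the result tells whether the moving pair stopped there: by `aux`, a pair that was
passed never looks like the stopped pair. -/
theorem insertPair_injective {k b c : ℕ} {L M : List (ℕ × ℕ)} (hL : Below b L)
    (hM : Below c M) (kL : Insertable k L) (kM : Insertable k M)
    (h : insertPair (2 * k + 1) L = insertPair (2 * k + 1) M) : L = M := by
  have aux : ∀ {k : ℕ} {q : ℕ × ℕ} {L : List (ℕ × ℕ)}, Insertable (k + 1) (q :: L) →
      ¬ 2 * (k + 1) > q.1 → (q.1 + 2, q.2 + 2) ≠ (2 * (k + 1) + 2, 2 * (k + 1)) := by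
    intro k q L hk hc h
    rw [Prod.mk.injEq] at h
    have := hk.2.1 (by omega) ⟨k, by omega⟩
    omega
  induction L generalizing k b c M with
  | nil =>
    cases M with
    | nil => rfl
    | cons r M =>
      exfalso
      rw [insertPair_odd_nil] at h
      cases k with
      | zero =>
        rw [insertPair_one_cons] at h
        simp only [List.cons.injEq, Prod.mk.injEq] at h
        have := hM.2.1
        omega
      | succ k =>
        rw [insertPair_odd_cons] at h
        split_ifs at h with hc
        · simp at h
        · exact aux kM hc (List.cons.inj h).1.symm
  | cons q L ih =>
    cases M with
    | nil =>
      exfalso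
      rw [insertPair_odd_nil] at h
      cases k with
      | zero =>
        rw [insertPair_one_cons] at h
        simp only [List.cons.injEq, Prod.mk.injEq] at h
        have := hL.2.1
        omega
      | succ k =>
        rw [insertPair_odd_cons] at h
        split_ifs at h with hc
        · simp at h
        · exact aux kL hc (List.cons.inj h).1
    | cons r M =>
      cases k with
      | zero =>
        rw [insertPair_one_cons, insertPair_one_cons] at h
        simp only [List.cons.injEq, Prod.mk.injEq] at h
        rw [h.2, Prod.ext (by omega : q.1 = r.1) h.1.2]
      | succ k =>
        rw [insertPair_odd_cons, insertPair_odd_cons] at h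
        split_ifs at h with hc hd hd
        · exact (List.cons.inj h).2
        · exact absurd (List.cons.inj h).1.symm (aux kM hd)
        · exact absurd (List.cons.inj h).1 (aux kL hc)
        · obtain ⟨h1, h2⟩ := List.cons.inj h
          rw [Prod.mk.injEq] at h1
          rw [ih hL.2.2 hM.2.2 kL.2.2 kM.2.2 h2,
            Prod.ext (by omega : q.1 = r.1) (by omega : q.2 = r.2)]

/-- All differences within the pairs are at most `2`. -/
def LeTwo (L : List (ℕ × ℕ)) : Prop := ∀ q ∈ L, q.1 ≤ q.2 + 2

theorem leTwo_cons {q : ℕ × ℕ} {L : List (ℕ × ℕ)} : LeTwo (q :: L) ↔ q.1 ≤ q.2 + 2 ∧ LeTwo L :=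
  List.forall_mem_cons

/-- A difference above `2` is created only when the moving pair has shrunk to `1` with pairs still
ahead, that is, when it has passed `k` pairs and the list is longer. -/
theorem leTwo_insertPair {k b : ℕ} {L : List (ℕ × ℕ)} (hL : Below b L) :
    LeTwo (insertPair (2 * k + 1) L) ↔ LeTwo L ∧ L.length ≤ k := by
  induction L generalizing k b with
  | nil =>
    rw [insertPair_odd_nil]
    simp [LeTwo]
  | cons q L ih =>
    obtain ⟨h1, h2, h3⟩ := hL
    cases k with
    | zero =>
      rw [insertPair_one_cons, leTwo_cons, List.length_cons]
      dsimp only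
      constructor
      · omega
      · omega
    | succ k =>
      rw [insertPair_odd_cons]
      split_ifs with hc
      · have := h3.two_mul_length_le
        rw [leTwo_cons, List.length_cons]
        dsimp only
        exact ⟨fun h => ⟨h.2, by omega⟩, fun h => ⟨by omega, h.1⟩⟩
      · rw [leTwo_cons, leTwo_cons, ih h3, List.length_cons, Nat.add_le_add_iff_right,
          Nat.add_le_add_iff_right, and_assoc]

theorem length_insertPair {k : ℕ} {L : List (ℕ × ℕ)} (h : L.length ≤ k) :
    (insertPair (2 * k + 1) L).length = L.length + 1 := by
  induction L generalizing k with
  | nil => rfl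
  | cons q L ih =>
    rw [List.length_cons] at h
    obtain ⟨k, rfl⟩ := Nat.exists_eq_add_of_lt h
    rw [show L.length + k + 1 = (L.length + k) + 1 from rfl, insertPair_odd_cons]
    split_ifs
    · rfl
    · rw [List.length_cons, ih (by omega), List.length_cons]

/-! ### Repeated insertion -/

/-- Lists that are insertable for every size: the pairs have differences `1`, or `2` with odd
entries. -/
def Primitive (L : List (ℕ × ℕ)) : Prop :=
  ∀ q ∈ L, q.1 = q.2 + 1 ∨ q.1 = q.2 + 2 ∧ Odd q.2

theorem Primitive.insertable {L : List (ℕ × ℕ)} (h : Primitive L) (k : ℕ) : Insertable k L := by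
  induction L generalizing k with
  | nil => trivial
  | cons q L ih =>
    obtain ⟨h1, h2⟩ := List.forall_mem_cons.mp h
    refine ⟨by omega, fun e1 e2 => ?_, ih h2 _⟩
    rcases h1 with h1 | h1
    · omega
    · exact absurd e2 (Nat.not_even_iff_odd.mpr h1.2)

/-- Insert `2k + 1` for all entries `k`, from right to left. -/
def insertAll (t : List ℕ) (L : List (ℕ × ℕ)) : List (ℕ × ℕ) :=
  t.foldr (fun k M => insertPair (2 * k + 1) M) L

theorem insertAll_cons (k : ℕ) (t : List ℕ) (L : List (ℕ × ℕ)) :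
    insertAll (k :: t) L = insertPair (2 * k + 1) (insertAll t L) := rfl

theorem insertAll_invariant {b : ℕ} {t : List ℕ} {L : List (ℕ × ℕ)} (ht : t.Pairwise (· ≤ ·))
    (hL : Below b L) (hP : Primitive L) :
    (∃ c, Below c (insertAll t L)) ∧ ∀ k, (∀ i ∈ t, k ≤ i) → Insertable k (insertAll t L) := by
  induction t with
  | nil => exact ⟨⟨b, hL⟩, fun k _ => hP.insertable k⟩
  | cons i t ih =>
    rw [List.pairwise_cons] at ht
    obtain ⟨⟨c, hc⟩, h2⟩ := ih ht.2
    have hi := h2 i ht.1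
    rw [insertAll_cons]
    refine ⟨⟨max c (2 * i + 1) + 2, below_insertPair (hc.mono (le_max_left _ _)) hi ?_⟩, ?_⟩
    · exact lt_of_lt_of_le (Nat.lt_succ_self _) (le_max_right _ _)
    · intro k hk
      exact (insertable_insertPair hc hi).1.mono (hk i (by simp))

/-- The entry inserted last is the largest `k` for which the result is `Insertable`; if there is no
largest one, nothing was inserted. -/
theorem insertAll_injective {b c : ℕ} {t u : List ℕ} {L M : List (ℕ × ℕ)}
    (ht : t.Pairwise (· ≤ ·)) (hu : u.Pairwise (· ≤ ·)) (hL : Below b L) (hM : Below c M)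
    (pL : Primitive L) (pM : Primitive M) (h : insertAll t L = insertAll u M) :
    t = u ∧ L = M := by
  induction t generalizing u with
  | nil =>
    cases u with
    | nil => exact ⟨rfl, h⟩
    | cons i u =>
      exfalso
      rw [List.pairwise_cons] at hu
      obtain ⟨⟨c, hc⟩, h2⟩ := insertAll_invariant hu.2 hM pM
      refine (insertable_insertPair hc (h2 i hu.1)).2 ?_
      rw [← insertAll_cons, ← h]
      exact pL.insertable _
  | cons i t ih =>
    have ht' := ht
    rw [List.pairwise_cons] at ht
    obtain ⟨⟨c₁, hc₁⟩, h₁⟩ := insertAll_invariant ht.2 hL pL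
    obtain ⟨j₁, j₂⟩ := insertable_insertPair hc₁ (h₁ i ht.1)
    cases u with
    | nil =>
      exfalso
      refine j₂ ?_
      rw [← insertAll_cons, h]
      exact pM.insertable _
    | cons j u =>
      rw [List.pairwise_cons] at hu
      obtain ⟨⟨c₂, hc₂⟩, h₂⟩ := insertAll_invariant hu.2 hM pM
      obtain ⟨l₁, l₂⟩ := insertable_insertPair hc₂ (h₂ j hu.1)
      rw [insertAll_cons, insertAll_cons] at h
      rw [← h] at l₁ l₂
      obtain rfl : i = j := by
        rcases lt_trichotomy i j with hij | hij | hij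
        · exact absurd (l₁.mono hij) j₂
        · exact hij
        · exact absurd (j₁.mono hij) l₂
      obtain ⟨e1, e2⟩ := ih ht.2 hu.2
        (insertPair_injective hc₁ hc₂ (h₁ i ht.1) (h₂ i hu.1) h)
      exact ⟨by rw [e1], e2⟩

/-- Each insertion of `2i + 1` requires at most `i` pairs to be present. The last insertion has the
smallest `i` and meets the most pairs, so its condition implies all the others. -/
theorem leTwo_insertAll {b : ℕ} {t : List ℕ} {L : List (ℕ × ℕ)} (ht : t.Pairwise (· ≤ ·))
    (hL : Below b L) (hP : Primitive L) :
    (LeTwo (insertAll t L) ↔ ∀ i ∈ t, L.length + t.length ≤ i + 1) ∧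
      (LeTwo (insertAll t L) → (insertAll t L).length = L.length + t.length) := by
  induction t with
  | nil =>
    refine ⟨⟨by simp, fun _ q hq => ?_⟩, fun _ => rfl⟩
    have := hP q hq
    omega
  | cons i t ih =>
    rw [List.pairwise_cons] at ht
    obtain ⟨⟨c, hc⟩, -⟩ := insertAll_invariant ht.2 hL hP
    obtain ⟨h1, h2⟩ := ih ht.2
    rw [insertAll_cons, leTwo_insertPair hc, List.length_cons]
    constructor
    · rw [List.forall_mem_cons]
      constructor
      · rintro ⟨h3, h4⟩
        rw [h2 h3] at h4
        refine ⟨by omega, fun j hj => ?_⟩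
        have := ht.1 j hj
        omega
      · rintro ⟨h3, h4⟩
        have h5 : LeTwo (insertAll t L) := h1.mpr fun j hj => by
          have := h4 j hj
          omega
        exact ⟨h5, by rw [h2 h5]; omega⟩
    · rintro ⟨h3, h4⟩
      rw [length_insertPair h4, h2 h3]
      omega

/-! ### Bressoud's map -/

/-- The number of pairs of the form `(a + 1, a)`. -/
def numOne : List (ℕ × ℕ) → ℕ
  | [] => 0
  | q :: L => if q.1 = q.2 + 1 then numOne L + 1 else numOne L

/-- The sums of the pairs `(a + 1, a)`, each increased by `4` for every other pair to the left. -/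
def normOne : List (ℕ × ℕ) → List ℕ
  | [] => []
  | q :: L => if q.1 = q.2 + 1 then (q.1 + q.2) :: normOne L else (normOne L).map (· + 4)

/-- The sums of the pairs not of the form `(a + 1, a)`, each decreased by `4` for every pair
`(a + 1, a)` to the right. -/
def normTwo : List (ℕ × ℕ) → List ℤ
  | [] => []
  | q :: L => if q.1 = q.2 + 1 then normTwo L else ((q.1 + q.2 : ℤ) - 4 * numOne L) :: normTwo L

theorem length_normOne (L : List (ℕ × ℕ)) : (normOne L).length = numOne L := by
  induction L with
  | nil => rfl
  | cons q L ih =>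
    rw [normOne, numOne]
    split_ifs <;> simp [ih]

/-- An interchange moves `4` from the sum of the pair `(a + 1, a)` to the sum of the pair it passes,
which is what the corrections in `normOne` and `normTwo` offset. -/
theorem norm_interchange (p : ℕ × ℕ) (L : List (ℕ × ℕ)) :
    numOne (interchange p L) = numOne (p :: L) ∧ normOne (interchange p L) = normOne (p :: L) ∧
      normTwo (interchange p L) = normTwo (p :: L) := by
  induction L generalizing p with
  | nil => simp [interchange]
  | cons q L ih =>
    rw [interchange]
    split_ifs with h
    · obtain ⟨h1, h2, h3⟩ := ih (p.1 - 2, p.2 - 2)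
      obtain ⟨hp, hq, -, -, hp2⟩ := h
      have e1 : p.1 - 2 = p.2 - 2 + 1 := by omega
      have e2 : ¬ q.1 = q.2 + 1 := by omega
      have e3 : ¬ q.1 + 2 = q.2 + 2 + 1 := by omega
      have e4 : p.2 + 1 - 2 + (p.2 - 2) + 4 = p.2 + 1 + p.2 := by omega
      simp only [numOne, normOne, normTwo, h1, h2, h3, if_pos hp, if_pos e1, if_neg e2, if_neg e3]
      refine ⟨trivial, ?_, ?_⟩
      · rw [List.map_cons, hp, e4]
      · push_cast
        congr 1
        ring
    · exact ⟨rfl, rfl, rfl⟩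

theorem norm_interchangeAll (L : List (ℕ × ℕ)) :
    numOne (interchangeAll L) = numOne L ∧ normOne (interchangeAll L) = normOne L ∧
      normTwo (interchangeAll L) = normTwo L := by
  induction L with
  | nil => exact ⟨rfl, rfl, rfl⟩
  | cons p L ih =>
    obtain ⟨h1, h2, h3⟩ := ih
    obtain ⟨i1, i2, i3⟩ := norm_interchange p (interchangeAll L)
    change numOne (interchange p (interchangeAll L)) = _ ∧
      normOne (interchange p (interchangeAll L)) = _ ∧
      normTwo (interchange p (interchangeAll L)) = _
    rw [i1, i2, i3]
    simp only [numOne, normOne, normTwo, h1, h2, h3, and_self]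

theorem length_interchange (p : ℕ × ℕ) (L : List (ℕ × ℕ)) :
    (interchange p L).length = L.length + 1 := by
  induction L generalizing p with
  | nil => rfl
  | cons q L ih =>
    rw [interchange]
    split_ifs
    · rw [List.length_cons, ih, List.length_cons]
    · rfl

theorem length_interchangeAll (L : List (ℕ × ℕ)) : (interchangeAll L).length = L.length := by
  induction L with
  | nil => rfl
  | cons p L ih => exact (length_interchange p _).trans (congrArg (· + 1) ih)

theorem primitive_interchange {p : ℕ × ℕ} {L : List (ℕ × ℕ)} (h : Primitive (p :: L)) :
    Primitive (interchange p L) := by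
  induction L generalizing p with
  | nil => exact h
  | cons q L ih =>
    rw [interchange]
    split_ifs with ho
    · obtain ⟨-, h2⟩ := List.forall_mem_cons.mp h
      obtain ⟨h3, h4⟩ := List.forall_mem_cons.mp h2
      obtain ⟨o1, o2, o3, -, o5⟩ := ho
      refine List.forall_mem_cons.mpr ⟨Or.inr ⟨?_, ?_⟩, ih (List.forall_mem_cons.mpr ⟨Or.inl ?_, h4⟩)⟩
      · dsimp only
        omega
      · exact o3.add_even even_two
      · dsimp only
        omega
    · exact h

theorem primitive_interchangeAll {L : List (ℕ × ℕ)} (h : Primitive L) :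
    Primitive (interchangeAll L) := by
  induction L with
  | nil => exact h
  | cons p L ih =>
    obtain ⟨h1, h2⟩ := List.forall_mem_cons.mp h
    exact primitive_interchange (List.forall_mem_cons.mpr ⟨h1, ih h2⟩)

/-- The pairs come from odd numbers, as in `pairing`, with gaps of at least `4` in between. -/
def Gapped : ℕ → List (ℕ × ℕ) → Prop
  | _, [] => True
  | b, q :: L => (q.1 = q.2 + 1 ∧ q.1 + q.2 + 4 ≤ b ∧ Gapped (q.1 + q.2) L) ∨
      (q.1 = q.2 + 2 ∧ Odd q.2 ∧ q.1 + 4 ≤ b ∧ Gapped q.1 L)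

theorem Gapped.primitive {b : ℕ} {L : List (ℕ × ℕ)} (h : Gapped b L) : Primitive L := by
  induction L generalizing b with
  | nil => simp [Primitive]
  | cons q L ih =>
    rcases h with ⟨h1, -, h3⟩ | ⟨h1, h2, -, h4⟩
    · exact List.forall_mem_cons.mpr ⟨Or.inl h1, ih h3⟩
    · exact List.forall_mem_cons.mpr ⟨Or.inr ⟨h1, h2⟩, ih h4⟩

theorem Gapped.length_le {b : ℕ} {L : List (ℕ × ℕ)} (h : Gapped b L) (hb : 1 ≤ b) :
    4 * L.length + 1 ≤ b := by
  induction L generalizing b with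
  | nil => simpa using hb
  | cons q L ih =>
    rw [List.length_cons]
    rcases h with ⟨h1, h2, h3⟩ | ⟨h1, h2, h3, h4⟩
    · have := ih h3 (by omega)
      omega
    · have := ih h4 (by omega)
      omega

/-- The gap of `4` after a pair of the second kind pays for the `4` that it adds to later sums. -/
theorem Gapped.normOne_le {b : ℕ} {L : List (ℕ × ℕ)} (h : Gapped b L) :
    ∀ a ∈ normOne L, a + 4 ≤ b := by
  induction L generalizing b with
  | nil => simp [normOne]
  | cons q L ih =>
    rw [normOne]
    rcases h with ⟨h1, h2, h3⟩ | ⟨h1, h2, h3, h4⟩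
    · rw [if_pos h1, List.forall_mem_cons]
      refine ⟨h2, fun a ha => ?_⟩
      have := ih h3 a ha
      omega
    · rw [if_neg (by omega)]
      simp only [List.mem_map]
      rintro _ ⟨a, ha, rfl⟩
      have := ih h4 a ha
      omega

/-- The constant `10` makes the bound sharp for a leading pair of difference `2`: its sum is `2 *
q.1 - 2`, and the gap contributes `2 * 4`. -/
theorem Gapped.normTwo_le {b : ℕ} {L : List (ℕ × ℕ)} (h : Gapped b L) :
    ∀ e ∈ normTwo L, e + 10 + 4 * numOne L ≤ 2 * b := by
  induction L generalizing b with
  | nil => simp [normTwo]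
  | cons q L ih =>
    rw [normTwo, numOne]
    rcases h with ⟨h1, h2, h3⟩ | ⟨h1, h2, h3, h4⟩
    · rw [if_pos h1, if_pos h1]
      intro e he
      have := ih h3 e he
      push_cast at this ⊢
      omega
    · rw [if_neg (by omega), if_neg (by omega), List.forall_mem_cons]
      refine ⟨by omega, fun e he => ?_⟩
      have := ih h4 e he
      omega

theorem Gapped.eq_of_norm_eq {b c : ℕ} {L M : List (ℕ × ℕ)} (hL : Gapped b L) (hM : Gapped c M)
    (h1 : normOne L = normOne M) (h2 : normTwo L = normTwo M) : L = M := by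
  -- Heads of different kinds are incompatible: with `s = q.1 + q.2`, the first norm gives `s ≤ r.1`
  -- and the second gives `r.1 + 2 ≤ s`.
  have mixed : ∀ {q r : ℕ × ℕ} {L M : List (ℕ × ℕ)}, q.1 = q.2 + 1 → Gapped (q.1 + q.2) L →
      r.1 = r.2 + 2 → Gapped r.1 M → normOne (q :: L) = normOne (r :: M) →
      normTwo (q :: L) ≠ normTwo (r :: M) := by
    intro q r L M hq hL hr hM h1 h2
    have hn := length_normOne (q :: L)
    rw [h1, length_normOne, numOne, numOne, if_neg (by omega), if_pos hq] at hn
    rw [normOne, normOne, if_pos hq, if_neg (by omega)] at h1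
    rw [normTwo, normTwo, if_pos hq, if_neg (by omega)] at h2
    have m1 : q.1 + q.2 ∈ (normOne M).map (· + 4) := by simp [← h1]
    obtain ⟨a, ha, hqa⟩ := List.mem_map.mp m1
    have b1 := hM.normOne_le a ha
    have b2 := hL.normTwo_le ((r.1 + r.2 : ℤ) - 4 * numOne M) (by simp [h2])
    omega
  induction L generalizing b c M with
  | nil =>
    cases M with
    | nil => rfl
    | cons r M =>
      exfalso
      rcases hM with ⟨hr, -, -⟩ | ⟨hr, -, -, -⟩
      · rw [normOne, normOne, if_pos hr] at h1
        simp at h1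
      · rw [normTwo, normTwo, if_neg (by omega)] at h2
        simp at h2
  | cons q L ih =>
    cases M with
    | nil =>
      exfalso
      rcases hL with ⟨hr, -, -⟩ | ⟨hr, -, -, -⟩
      · rw [normOne, normOne, if_pos hr] at h1
        simp at h1
      · rw [normTwo, normTwo, if_neg (by omega)] at h2
        simp at h2
    | cons r M =>
      rcases hL with ⟨hq, -, hL⟩ | ⟨hq, -, -, hL⟩ <;> rcases hM with ⟨hr, -, hM⟩ | ⟨hr, -, -, hM⟩
      · rw [normOne, normOne, if_pos hq, if_pos hr] at h1
        rw [normTwo, normTwo, if_pos hq, if_pos hr] at h2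
        obtain ⟨e1, e2⟩ := List.cons.inj h1
        rw [ih hL hM e2 h2, Prod.ext (by omega : q.1 = r.1) (by omega)]
      · exact absurd h2 (mixed hq hL hr hM h1)
      · exact absurd h2.symm (mixed hr hM hq hL h1.symm)
      · have hn := length_normOne (q :: L)
        rw [h1, length_normOne, numOne, numOne, if_neg (by omega), if_neg (by omega)] at hn
        rw [normOne, normOne, if_neg (by omega), if_neg (by omega)] at h1
        rw [normTwo, normTwo, if_neg (by omega), if_neg (by omega)] at h2
        obtain ⟨e1, e2⟩ := List.cons.inj h2
        rw [ih hL hM (List.map_injective_iff.mpr (add_left_injective 4) h1) e2,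
          Prod.ext (by omega : q.1 = r.1) (by omega)]

/-- The bounds on length and on `normOne` survive each interchange, as the sum of `p`, four times
the length and the remaining norms all fall by `4`. The length bound gives `2 ≤ p.2` while pairs
remain, so only size can stop `p`; the other bound keeps pairs of the first kind in order. -/
theorem below_interchange {b : ℕ} {p : ℕ × ℕ} {L : List (ℕ × ℕ)} (hp : p.1 = p.2 + 1)
    (hP : Primitive L) (hL : Below b L) (hlen : 4 * L.length + 1 ≤ p.1 + p.2)
    (hone : ∀ a ∈ normOne L, a + 4 ≤ p.1 + p.2) (hb : p.1 < b + 2) :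
    Below (b + 2) (interchange p L) := by
  induction L generalizing b p with
  | nil => exact ⟨hb, by omega, trivial⟩
  | cons q L ih =>
    obtain ⟨l1, l2, l3⟩ := hL
    obtain ⟨p1, p2⟩ := List.forall_mem_cons.mp hP
    rw [List.length_cons] at hlen
    rw [normOne] at hone
    rw [interchange]
    split_ifs with h
    · obtain ⟨-, h2, -, h4, h5⟩ := h
      rw [if_neg (by omega)] at hone
      refine ⟨by dsimp only; omega, by dsimp only; omega, ih ?_ p2 l3 ?_ (fun a ha => ?_) ?_⟩
      · dsimp only
        omega
      · dsimp only
        omega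
      · have := hone (a + 4) (List.mem_map_of_mem ha)
        dsimp only
        omega
      · dsimp only
        omega
    · refine ⟨hb, by omega, ?_, l2, l3⟩
      rcases p1 with p1 | ⟨p1, p3⟩
      · rw [if_pos p1] at hone
        have := hone _ (List.mem_cons_self ..)
        omega
      · by_contra hlt
        exact h ⟨hp, p1, p3, by omega, by omega⟩

/-- The norm bounds carry over to the final list by invariance, and there they bound the head
directly. -/
theorem Gapped.head_interchangeAll_le {b : ℕ} {L : List (ℕ × ℕ)} (h : Gapped b L) :
    ∀ q ∈ (interchangeAll L).head?, q.1 + 4 ≤ b := by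
  have hP := primitive_interchangeAll h.primitive
  have n1 := h.normOne_le
  have n2 := h.normTwo_le
  obtain ⟨i0, i1, i2⟩ := norm_interchangeAll L
  rw [← i1] at n1
  rw [← i2, ← i0] at n2
  generalize interchangeAll L = K at *
  cases K with
  | nil => simp
  | cons q K =>
    simp only [List.head?_cons, Option.mem_some_iff, forall_eq']
    rcases (List.forall_mem_cons.mp hP).1 with hq | hq
    · have := n1 (q.1 + q.2) (by simp [normOne, hq])
      omega
    · have := n2 ((q.1 + q.2 : ℤ) - 4 * numOne K) (by simp [normTwo, hq])
      rw [numOne, if_neg (by omega)] at this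
      omega

theorem Gapped.below_interchangeAll {b : ℕ} {L : List (ℕ × ℕ)} (h : Gapped b L) :
    Below b (interchangeAll L) := by
  induction L generalizing b with
  | nil => trivial
  | cons p L ih =>
    change Below b (interchange p (interchangeAll L))
    rcases h with ⟨h1, h2, h3⟩ | ⟨h1, h2, h3, h4⟩
    · refine (below_interchange h1 (primitive_interchangeAll h3.primitive) (ih h3) ?_ ?_
        (by omega)).mono (by omega : p.1 + p.2 + 2 ≤ b)
      · rw [length_interchangeAll]
        exact h3.length_le (by omega)
      · rw [(norm_interchangeAll L).2.1]
        exact h3.normOne_le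
    · have hhead := h4.head_interchangeAll_le
      have hL := ih h4
      -- A pair of difference `2` never starts an interchange.
      have he : interchange p (interchangeAll L) = p :: interchangeAll L := by
        cases interchangeAll L with
        | nil => rfl
        | cons q K => rw [interchange, if_neg fun h => by have := h.1; omega]
      rw [he]
      refine ⟨by omega, by omega, ?_⟩
      generalize interchangeAll L = K at *
      cases K with
      | nil => trivial
      | cons q K =>
        have := hhead q rfl
        exact ⟨by omega, hL.2⟩

/-! ### Pairing -/

theorem doublePart_odd (m : ℕ) : doublePart (2 * m + 1) = (m + 1, m) := by
  unfold doublePart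
  rw [if_neg (by simp)]
  ext <;> dsimp only <;> omega

/-- A term `x` is left over only if `x - 2` is absent, so the next term is at most `x - 4`; after a
pair `(y + 2, y)` it is at most `y - 2`. -/
theorem gapped_pairing {b : ℕ} {l : List ℕ} (h : l.Pairwise (· > ·)) (ho : ∀ x ∈ l, Odd x)
    (hb : ∀ x ∈ l, x + 4 ≤ b) : Gapped b (pairing l) := by
  fun_induction pairing l generalizing b with
  | case1 => trivial
  | case2 x =>
    obtain ⟨m, rfl⟩ := ho x (by simp)
    have := hb (2 * m + 1) (by simp)
    rw [doublePart_odd]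
    exact Or.inl ⟨rfl, by dsimp only; omega, trivial⟩
  | case3 y l ih =>
    rw [List.pairwise_cons, List.pairwise_cons] at h
    have hy := ho y (by simp)
    refine Or.inr ⟨rfl, hy, hb _ (by simp), ih h.2.2 (fun z hz => ho z (by simp [hz])) ?_⟩
    intro z hz
    have h1 := h.2.1 z hz
    have h2 := (Nat.odd_iff.mp hy)
    have h3 := (Nat.odd_iff.mp (ho z (by simp [hz])))
    dsimp only
    omega
  | case4 x y l hxy ih =>
    rw [List.pairwise_cons] at h
    obtain ⟨m, rfl⟩ := ho x (by simp)
    have h0 := hb (2 * m + 1) (by simp)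
    rw [doublePart_odd]
    refine Or.inl ⟨rfl, by dsimp only; omega,
      ih h.2 (fun z hz => ho z (List.mem_cons_of_mem _ hz)) ?_⟩
    have h1 := h.1 y (by simp)
    have h2 := (Nat.odd_iff.mp (ho y (by simp)))
    have h3 : y + 4 ≤ m + 1 + m := by omega
    intro z hz
    rcases List.mem_cons.mp hz with rfl | hz
    · exact h3
    · have := (List.pairwise_cons.mp h.2).1 z hz
      dsimp only
      omega

/-- The odd number or the two odd numbers from which a pair arises in `pairing`. -/
def unpair (q : ℕ × ℕ) : List ℕ := if q.1 = q.2 + 1 then [q.1 + q.2] else [q.1, q.2]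

theorem flatMap_unpair_pairing {l : List ℕ} (ho : ∀ x ∈ l, Odd x) :
    (pairing l).flatMap unpair = l := by
  have h1 : ∀ x, Odd x → unpair (doublePart x) = [x] := by
    rintro _ ⟨m, rfl⟩
    rw [doublePart_odd, unpair, if_pos rfl]
    congr 1
    dsimp only
    omega
  fun_induction pairing l with
  | case1 => rfl
  | case2 x => simp [h1 x (ho x (by simp))]
  | case3 y l ih =>
    rw [List.flatMap_cons, ih fun z hz => ho z (by simp [hz]), unpair, if_neg (by simp)]
    rfl
  | case4 x y l hxy ih =>
    rw [List.flatMap_cons, ih fun z hz => ho z (List.mem_cons_of_mem _ hz), h1 x (ho x (by simp))]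
    rfl

theorem gapped_pairing_sum {l : List ℕ} (h : l.Pairwise (· > ·)) (ho : ∀ x ∈ l, Odd x) :
    Gapped (l.sum + 4) (pairing l) :=
  gapped_pairing h ho fun _ hx => Nat.add_le_add_right (List.le_sum_of_mem hx) 4

theorem bressoud_injective {l m : List ℕ} (hl : l.Pairwise (· > ·)) (hm : m.Pairwise (· > ·))
    (ol : ∀ x ∈ l, Odd x) (om : ∀ x ∈ m, Odd x) (h : bressoud l = bressoud m) : l = m := by
  obtain ⟨-, i1, i2⟩ := norm_interchangeAll (pairing l)
  obtain ⟨-, j1, j2⟩ := norm_interchangeAll (pairing m)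
  rw [bressoud, bressoud] at h
  have := (gapped_pairing_sum hl ol).eq_of_norm_eq (gapped_pairing_sum hm om)
    (by rw [← i1, h, j1]) (by rw [← i2, h, j2])
  rw [← flatMap_unpair_pairing ol, this, flatMap_unpair_pairing om]

/-! ### Odd runs -/

/-- The numbers `m` such that the odd number `2m + 1` is left over in `pairing`. -/
def leftovers : List ℕ → List ℕ
  | [] => []
  | [x] => [x / 2]
  | x :: y :: l => if x = y + 2 then leftovers l else x / 2 :: leftovers (y :: l)

theorem two_mul_length_pairing (l : List ℕ) :
    2 * (pairing l).length = l.length + (leftovers l).length := by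
  fun_induction pairing l with
  | case1 => rfl
  | case2 x => rfl
  | case3 y l ih =>
    rw [leftovers, if_pos rfl]
    simp only [List.length_cons]
    omega
  | case4 x y l hxy ih =>
    rw [leftovers, if_neg hxy]
    simp only [List.length_cons] at ih ⊢
    omega

theorem two_mul_add_one_mem_of_mem_leftovers {l : List ℕ} (ho : ∀ x ∈ l, Odd x) {m : ℕ}
    (hm : m ∈ leftovers l) : 2 * m + 1 ∈ l := by
  have h1 : ∀ x, Odd x → 2 * (x / 2) + 1 = x := fun x hx => Nat.two_mul_div_two_add_one_of_odd hx
  fun_induction leftovers l with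
  | case1 => simp at hm
  | case2 x =>
    rw [List.mem_singleton] at hm
    rw [hm, h1 x (ho x (by simp))]
    simp
  | case3 y l ih =>
    have := ih (fun z hz => ho z (by simp [hz])) hm
    simp [this]
  | case4 x y l hxy ih =>
    rcases List.mem_cons.mp hm with hm | hm
    · rw [hm, h1 x (ho x (by simp))]
      simp
    · exact List.mem_cons_of_mem _ (ih (fun z hz => ho z (List.mem_cons_of_mem _ hz)) hm)

theorem nodup_leftovers {l : List ℕ} (h : l.Pairwise (· > ·)) (ho : ∀ x ∈ l, Odd x) :
    (leftovers l).Nodup := by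
  fun_induction leftovers l with
  | case1 => simp
  | case2 x => simp
  | case3 y l ih =>
    rw [List.pairwise_cons, List.pairwise_cons] at h
    exact ih h.2.2 fun z hz => ho z (by simp [hz])
  | case4 x y l hxy ih =>
    rw [List.pairwise_cons] at h
    have ho' : ∀ z ∈ y :: l, Odd z := fun z hz => ho z (List.mem_cons_of_mem _ hz)
    refine List.nodup_cons.mpr ⟨fun hm => ?_, ih h.2 ho'⟩
    have := h.1 _ (two_mul_add_one_mem_of_mem_leftovers ho' hm)
    have := Nat.two_mul_div_two_add_one_of_odd (ho x (by simp))
    omega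

/-- The odd numbers from `2b + 1` to `2b + 2k - 1` are a maximal sequence of consecutive odd
numbers in a list. -/
def HasRun (l : List ℕ) (b k : ℕ) : Prop :=
  1 ≤ k ∧ (∀ i < k, 2 * (b + i) + 1 ∈ l) ∧ 2 * (b + k) + 1 ∉ l ∧ ∀ c, b = c + 1 → 2 * c + 1 ∉ l

/-- Removing the two largest terms of a run preserves the parity of its length, and a largest term
without successor `x - 2` is a run of length `1`. -/
theorem mem_leftovers_iff {l : List ℕ} (h : l.Pairwise (· > ·)) (ho : ∀ x ∈ l, Odd x) (b : ℕ) :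
    b ∈ leftovers l ↔ ∃ k, Odd k ∧ HasRun l b k := by
  fun_induction leftovers l with
  | case1 =>
    simp only [List.not_mem_nil, false_iff]
    rintro ⟨k, -, h1, h2, -⟩
    exact absurd (h2 0 h1) List.not_mem_nil
  | case2 x =>
    obtain ⟨m, rfl⟩ := ho x (by simp)
    rw [List.mem_singleton]
    constructor
    · intro hb
      obtain rfl : b = m := by omega
      refine ⟨1, odd_one, le_rfl, fun i hi => ?_, ?_, fun c hc => ?_⟩
      · rw [List.mem_singleton]
        omega
      · rw [List.mem_singleton]
        omega
      · rw [List.mem_singleton]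
        omega
    · rintro ⟨k, -, h1, h2, -⟩
      have := List.mem_singleton.mp (h2 0 h1)
      omega
  | case3 y l ih =>
    rw [List.pairwise_cons, List.pairwise_cons] at h
    have ho' : ∀ z ∈ l, Odd z := fun z hz => ho z (by simp [hz])
    obtain ⟨m, rfl⟩ := ho y (by simp)
    have hlt : ∀ z, 2 * z + 1 ∈ l → z < m := fun z hz => by
      have := h.2.1 _ hz
      omega
    have hmem : ∀ z, 2 * z + 1 ∈ (2 * m + 1 + 2) :: (2 * m + 1) :: l ↔
        z = m + 1 ∨ z = m ∨ 2 * z + 1 ∈ l := by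
      intro z
      rw [List.mem_cons, List.mem_cons, show 2 * z + 1 = 2 * m + 1 + 2 ↔ z = m + 1 by omega,
        show 2 * z + 1 = 2 * m + 1 ↔ z = m by omega]
    rw [ih h.2.2 ho']
    constructor
    · rintro ⟨k, k0, k1, k2, k3, k4⟩
      have hbm := hlt _ (k2 (k - 1) (by omega))
      -- Either the run ends just below the removed pair and is lengthened by it, or it is
      -- unaffected.
      by_cases hk : b + k = m
      · refine ⟨k + 2, k0.add_even even_two, by omega, fun i hi => ?_, ?_, fun c hc => ?_⟩
        · rw [hmem]
          by_cases hik : i < k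
          · exact Or.inr (Or.inr (k2 i hik))
          · omega
        · rw [hmem]
          rintro (h | h | h)
          · omega
          · omega
          · have := hlt _ h
            omega
        · rw [hmem]
          rintro (h | h | h)
          · omega
          · omega
          · exact k4 c hc h
      · refine ⟨k, k0, k1, fun i hi => (hmem _).mpr (Or.inr (Or.inr (k2 i hi))), ?_,
          fun c hc => ?_⟩
        · rw [hmem]
          rintro (h | h | h)
          · omega
          · omega
          · exact k3 h
        · rw [hmem]
          rintro (h | h | h)
          · omega
          · omega
          · exact k4 c hc h
    · rintro ⟨k, k0, k1, k2, k3, k4⟩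
      simp only [hmem] at k2 k3 k4
      obtain ⟨j, rfl⟩ := k0
      -- A run starting at `m + 1` would not be maximal, and one starting at `m` has length `2`,
      -- which is even.
      have hb : b < m := by
        rcases k2 0 (by omega) with hb | hb | hb
        · exact absurd (Or.inr (Or.inl rfl)) (k4 m (by omega))
        · by_cases hj : j = 0
          · exact absurd (Or.inl (by omega)) k3
          · rcases k2 2 (by omega) with hc | hc | hc
            · omega
            · omega
            · have := hlt _ hc
              omega
        · have := hlt _ hb
          omega
      have hk3 : 2 * (b + (2 * j + 1)) + 1 ∉ l := fun hc => k3 (Or.inr (Or.inr hc))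
      have hk4 : ∀ c, b = c + 1 → 2 * c + 1 ∉ l := fun c hc hd => k4 c hc (Or.inr (Or.inr hd))
      by_cases hm : m < b + (2 * j + 1)
      · have hm2 : b + (2 * j + 1) = m + 2 := by
          rcases k2 (2 * j) (by omega) with hc | hc | hc
          · omega
          · exact absurd (Or.inl (by omega)) k3
          · have := hlt _ hc
            omega
        refine ⟨2 * (j - 1) + 1, ⟨j - 1, rfl⟩, by omega, fun i hi => ?_, fun hc => ?_, hk4⟩
        · rcases k2 i (by omega) with hc | hc | hc
          · omega
          · omega
          · exact hc
        · have := hlt _ hc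
          omega
      · refine ⟨2 * j + 1, ⟨j, rfl⟩, k1, fun i hi => ?_, hk3, hk4⟩
        rcases k2 i hi with hc | hc | hc
        · omega
        · omega
        · exact hc
  | case4 x y l hxy ih =>
    rw [List.pairwise_cons] at h
    have ho' : ∀ z ∈ y :: l, Odd z := fun z hz => ho z (List.mem_cons_of_mem _ hz)
    rw [List.mem_cons, ih h.2 ho']
    obtain ⟨m, rfl⟩ := ho x (by simp)
    have hlt : ∀ z, 2 * z + 1 ∈ y :: l → z + 1 < m := by
      intro z hz
      have h1 := h.1 _ hz
      have h2 := h.1 y (by simp)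
      have h3 := Nat.odd_iff.mp (ho' y (by simp))
      rcases List.mem_cons.mp hz with h4 | h4
      · omega
      · have := (List.pairwise_cons.mp h.2).1 _ h4
        omega
    have hmem : ∀ z, 2 * z + 1 ∈ (2 * m + 1) :: y :: l ↔ z = m ∨ 2 * z + 1 ∈ y :: l := by
      intro z
      rw [List.mem_cons, show 2 * z + 1 = 2 * m + 1 ↔ z = m by omega]
    constructor
    · rintro (hb | ⟨k, k0, k1, k2, k3, k4⟩)
      · obtain rfl : b = m := by omega
        refine ⟨1, odd_one, le_rfl, fun i hi => ?_, ?_, fun c hc => ?_⟩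
        · rw [hmem]
          omega
        · rw [hmem]
          rintro (h | h)
          · omega
          · have := hlt _ h
            omega
        · rw [hmem]
          rintro (h | h)
          · omega
          · have := hlt _ h
            omega
      · have hbm := hlt _ (k2 (k - 1) (by omega))
        refine ⟨k, k0, k1, fun i hi => (hmem _).mpr (Or.inr (k2 i hi)), ?_, fun c hc => ?_⟩
        · rw [hmem]
          rintro (h | h)
          · omega
          · exact k3 h
        · rw [hmem]
          rintro (h | h)
          · omega
          · exact k4 c hc h
    · rintro ⟨k, k0, k1, k2, k3, k4⟩
      simp only [hmem] at k2 k3 k4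
      by_cases hb : b = m
      · exact Or.inl (by omega)
      · have hb' : b < m := by
          rcases k2 0 (by omega) with hc | hc
          · omega
          · have := hlt _ hc
            omega
        have hin : ∀ i < k, b + i < m := by
          intro i
          induction i with
          | zero => intro _; exact hb'
          | succ i ihi =>
            intro hi
            rcases k2 i (by omega) with hc | hc
            · have := ihi (by omega)
              omega
            · have := hlt _ hc
              omega
        refine Or.inr ⟨k, k0, k1, fun i hi => ?_, fun hc => k3 (Or.inr hc),
          fun c hc hd => k4 c hc (Or.inr hd)⟩
        rcases k2 i hi with hc | hc
        · have := hin i hi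
          omega
        · exact hc

theorem mem_sortedParts_oddPart {s : Multiset ℕ} {x : ℕ} :
    x ∈ sortedParts (oddPart s) ↔ Odd (s.count x) := by
  rw [mem_sortedParts, oddPart, Multiset.mem_filter, Multiset.mem_dedup]
  exact ⟨fun h => h.2, fun h => ⟨Multiset.count_pos.mp h.pos, h⟩⟩

theorem isRun_iff {s : Multiset ℕ} {b k : ℕ} :
    IsRun s (b + k) k ↔ HasRun (sortedParts (oddPart s)) b k := by
  unfold IsRun HasRun
  simp only [mem_sortedParts_oddPart, Nat.not_odd_iff_even]
  constructor
  · rintro ⟨h1, -, h3, h4, h5⟩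
    refine ⟨h1, fun i hi => ?_, h4, fun c hc => ?_⟩
    · have := h3 (k - 1 - i) (by omega)
      rwa [show 2 * (b + k - (k - 1 - i)) - 1 = 2 * (b + i) + 1 by omega] at this
    · have := h5 (by omega)
      rwa [show 2 * (b + k - k) - 1 = 2 * c + 1 by omega] at this
  · rintro ⟨h1, h3, h4, h5⟩
    refine ⟨h1, by omega, fun i hi => ?_, h4, fun hk => ?_⟩
    · have := h3 (k - 1 - i) (by omega)
      rwa [show 2 * (b + (k - 1 - i)) + 1 = 2 * (b + k - i) - 1 by omega] at this
    · have := h5 (b - 1) (by omega)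
      rwa [show 2 * (b - 1) + 1 = 2 * (b + k - k) - 1 by omega] at this

theorem HasRun.eq {l : List ℕ} {b j k : ℕ} (hj : HasRun l b j) (hk : HasRun l b k) : j = k := by
  rcases lt_trichotomy j k with h | h | h
  · exact absurd (hk.2.1 j h) hj.2.2.1
  · exact h
  · exact absurd (hj.2.1 k h) hk.2.2.1

/-- A run given by `(m, k)` has smallest term `2(m - k) + 1`; the condition `k < m` discards the run
containing `1`, hence `erase 0`. -/
theorem oddRuns_eq {s : Multiset ℕ} (hs : ∀ x ∈ s, Odd x) :
    oddRuns s = ((leftovers (sortedParts (oddPart s))).toFinset.erase 0).card := by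
  have hn : (oddPart s).Nodup := (Multiset.nodup_dedup s).filter _
  have ho : ∀ x ∈ sortedParts (oddPart s), Odd x := fun x hx =>
    hs x (Multiset.count_pos.mp (mem_sortedParts_oddPart.mp hx).pos)
  rw [oddRuns, ← Set.ncard_coe_finset]
  refine Set.ncard_congr (fun r _ => r.1 - r.2) ?_ ?_ ?_
  · rintro ⟨m, k⟩ ⟨h1, h2, h3⟩
    dsimp only at h1 h2 h3 ⊢
    obtain ⟨b, rfl⟩ := Nat.exists_eq_add_of_le' h1.2.1
    rw [Nat.add_sub_cancel]
    simp only [Finset.coe_erase, Set.mem_sdiff, Set.mem_singleton_iff, Finset.mem_coe,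
      List.mem_toFinset]
    exact ⟨(mem_leftovers_iff (sortedParts_pairwise_gt hn) ho b).mpr ⟨k, h2, isRun_iff.mp h1⟩,
      by omega⟩
  · rintro ⟨m, k⟩ ⟨m', k'⟩ ⟨h1, h2, h3⟩ ⟨h1', h2', h3'⟩ he
    dsimp only at h1 h2 h3 h1' h2' h3' he ⊢
    obtain ⟨b, rfl⟩ := Nat.exists_eq_add_of_le' h1.2.1
    obtain ⟨b', rfl⟩ := Nat.exists_eq_add_of_le' h1'.2.1
    rw [Nat.add_sub_cancel, Nat.add_sub_cancel] at he
    subst he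
    rw [(isRun_iff.mp h1).eq (isRun_iff.mp h1')]
  · intro b hb
    simp only [Finset.coe_erase, Set.mem_sdiff, Set.mem_singleton_iff, Finset.mem_coe,
      List.mem_toFinset] at hb
    obtain ⟨k, hk, hr⟩ := (mem_leftovers_iff (sortedParts_pairwise_gt hn) ho b).mp hb.1
    exact ⟨(b + k, k), ⟨isRun_iff.mpr hr, hk, by dsimp only; omega⟩, Nat.add_sub_cancel b k⟩

/-- The slack of `1` is the possible leftover term `1`, which yields a pair but no odd run. -/
theorem length_bressoud_oddPart {s : Multiset ℕ} (hs : ∀ x ∈ s, Odd x) :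
    (oddPart s).card + oddRuns s ≤ 2 * (bressoud (sortedParts (oddPart s))).length ∧
      2 * (bressoud (sortedParts (oddPart s))).length ≤ (oddPart s).card + oddRuns s + 1 := by
  have hn : (oddPart s).Nodup := (Multiset.nodup_dedup s).filter _
  have ho : ∀ x ∈ sortedParts (oddPart s), Odd x := fun x hx =>
    hs x (Multiset.count_pos.mp (mem_sortedParts_oddPart.mp hx).pos)
  have hc : (sortedParts (oddPart s)).length = (oddPart s).card := by
    rw [← Multiset.coe_card, coe_sortedParts]
  rw [bressoud, length_interchangeAll, two_mul_length_pairing, hc, oddRuns_eq hs]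
  have h1 := List.toFinset_card_of_nodup (nodup_leftovers (sortedParts_pairwise_gt hn) ho)
  have h2 := Finset.card_erase_le (s := (leftovers (sortedParts (oddPart s))).toFinset) (a := 0)
  have h3 := Finset.pred_card_le_card_erase
    (s := (leftovers (sortedParts (oddPart s))).toFinset) (a := 0)
  omega

/-! ### The bijection -/

theorem mem_halfPart {s : Multiset ℕ} {x : ℕ} : x ∈ halfPart s ↔ 2 ≤ s.count x := by
  rw [halfPart, Multiset.mem_bind]
  simp only [Multiset.mem_dedup, Multiset.mem_replicate]
  constructor
  · rintro ⟨y, -, h, rfl⟩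
    omega
  · intro h
    exact ⟨x, Multiset.count_pos.mp (by omega), by omega, rfl⟩

theorem mem_odds {n : ℕ} {l : n.Partition} :
    l ∈ Nat.Partition.odds n ↔ ∀ x ∈ l.parts, Odd x := by
  simp [Nat.Partition.odds, Nat.Partition.restricted]

/-- The increasing list of all `k` such that the pair `2k + 1, 2k + 1` is inserted. -/
def halfList (s : Multiset ℕ) : List ℕ := (sortedParts (halfPart s)).reverse.map (· / 2)

theorem halfList_pairwise (s : Multiset ℕ) : (halfList s).Pairwise (· ≤ ·) := by
  rw [halfList, List.pairwise_map, List.pairwise_reverse]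
  exact (sortedParts_pairwise _).imp fun h => Nat.div_le_div_right h

theorem length_halfList (s : Multiset ℕ) : (halfList s).length = (halfPart s).card := by
  rw [halfList, List.length_map, List.length_reverse, ← Multiset.coe_card, coe_sortedParts]

theorem map_halfList {s : Multiset ℕ} (hs : ∀ x ∈ s, Odd x) :
    (halfList s).map (fun k => 2 * k + 1) = (sortedParts (halfPart s)).reverse := by
  rw [halfList, List.map_map]
  conv_rhs => rw [← List.map_id (sortedParts (halfPart s)).reverse]
  refine List.map_congr_left fun x hx => Nat.two_mul_div_two_add_one_of_odd (hs x ?_)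
  rw [List.mem_reverse, mem_sortedParts, mem_halfPart] at hx
  exact Multiset.count_pos.mp (by omega)

theorem imagePairs_eq {s : Multiset ℕ} (hs : ∀ x ∈ s, Odd x) :
    imagePairs s = insertAll (halfList s) (bressoud (sortedParts (oddPart s))) := by
  rw [imagePairs, insertAll, ← List.foldr_map (f := fun k => 2 * k + 1) (g := insertPair),
    map_halfList hs, List.foldr_reverse]

theorem odd_of_mem_oddPart {s : Multiset ℕ} (hs : ∀ x ∈ s, Odd x) :
    ∀ x ∈ sortedParts (oddPart s), Odd x := fun x hx =>
  hs x (Multiset.count_pos.mp (mem_sortedParts_oddPart.mp hx).pos)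

theorem oddPart_pairwise (s : Multiset ℕ) : (sortedParts (oddPart s)).Pairwise (· > ·) :=
  sortedParts_pairwise_gt ((Multiset.nodup_dedup s).filter _)

theorem bressoud_oddPart {s : Multiset ℕ} (hs : ∀ x ∈ s, Odd x) :
    (∃ b, Below b (bressoud (sortedParts (oddPart s)))) ∧
      Primitive (bressoud (sortedParts (oddPart s))) := by
  have := gapped_pairing_sum (oddPart_pairwise s) (odd_of_mem_oddPart hs)
  exact ⟨⟨_, this.below_interchangeAll⟩, primitive_interchangeAll this.primitive⟩

theorem pairsOf_oddToDistinct {n : ℕ} {l : n.Partition} (h : l ∈ Nat.Partition.odds n) :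
    (∃ b, Below b (imagePairs l.parts)) ∧ oddToDistinct l ∈ Nat.Partition.distincts n ∧
      pairsOf (oddToDistinct l) = imagePairs l.parts := by
  have hs := mem_odds.mp h
  obtain ⟨⟨b, hb⟩, hP⟩ := bressoud_oddPart hs
  obtain ⟨⟨c, hc⟩, -⟩ := insertAll_invariant (halfList_pairwise l.parts) hb hP
  rw [← imagePairs_eq hs] at hc
  exact ⟨⟨c, hc⟩, ofSums_parts_of_below hc _⟩

theorem bijOn_oddToDistinct (n : ℕ) :
    Set.BijOn (oddToDistinct (n := n))
      {l | l ∈ Nat.Partition.odds n} {ν | ν ∈ Nat.Partition.distincts n} := by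
  have hm : Set.MapsTo (oddToDistinct (n := n)) (Nat.Partition.odds n : Set n.Partition)
      (Nat.Partition.distincts n : Set n.Partition) := fun l hl => (pairsOf_oddToDistinct hl).2.1
  have hi : Set.InjOn (oddToDistinct (n := n)) (Nat.Partition.odds n : Set n.Partition) := by
    intro l hl m hm h
    have e : imagePairs l.parts = imagePairs m.parts := by
      rw [← (pairsOf_oddToDistinct hl).2.2, h, (pairsOf_oddToDistinct hm).2.2]
    have ol := mem_odds.mp hl
    have om := mem_odds.mp hm
    obtain ⟨⟨b, hb⟩, pl⟩ := bressoud_oddPart ol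
    obtain ⟨⟨c, hc⟩, pm⟩ := bressoud_oddPart om
    rw [imagePairs_eq ol, imagePairs_eq om] at e
    obtain ⟨e1, e2⟩ := insertAll_injective (halfList_pairwise _) (halfList_pairwise _) hb hc pl pm e
    have e3 := bressoud_injective (oddPart_pairwise _) (oddPart_pairwise _)
      (odd_of_mem_oddPart ol) (odd_of_mem_oddPart om) e2
    have e4 := map_halfList ol
    rw [e1, map_halfList om, List.reverse_inj] at e4
    ext1
    rw [← halfPart_add_oddPart l.parts, ← coe_sortedParts (halfPart l.parts), ← e4,
      ← coe_sortedParts (oddPart l.parts), e3, coe_sortedParts, coe_sortedParts,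
      halfPart_add_oddPart]
  -- Surjectivity by counting, from Euler's theorem.
  exact ⟨hm, hi, Finset.surjOn_of_injOn_of_card_le _ hm hi
    (Nat.Partition.card_odds_eq_card_distincts n).ge⟩

theorem mem_oddDistinctSmall {n : ℕ} {l : n.Partition} :
    l ∈ oddDistinctSmall n ↔ l ∈ Nat.Partition.odds n ∧
      ∀ i : ℕ, 2 ≤ l.parts.count i → l.parts.card + oddRuns l.parts ≤ i + 1 := by
  refine and_congr_right fun _ => ⟨fun h i hi => ?_, fun h i _ hi => ?_⟩
  · have h0 := l.parts_pos (Multiset.count_pos.mp (by omega : 0 < l.parts.count i))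
    have := h i h0
    omega
  · have := h i
    omega

theorem leTwo_imagePairs {s : Multiset ℕ} (hs : ∀ x ∈ s, Odd x) :
    LeTwo (imagePairs s) ↔ ∀ i : ℕ, 2 ≤ s.count i → s.card + oddRuns s ≤ i + 1 := by
  obtain ⟨⟨b, hb⟩, hP⟩ := bressoud_oddPart hs
  have hc := congrArg Multiset.card (halfPart_add_oddPart s)
  rw [Multiset.card_add, Multiset.card_add] at hc
  have h2 : (∀ i : ℕ, 2 ≤ s.count i → s.card + oddRuns s ≤ i + 1) ↔
      ∀ x ∈ (halfList s).map (fun k => 2 * k + 1), s.card + oddRuns s ≤ x + 1 := by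
    simp only [map_halfList hs, List.mem_reverse, mem_sortedParts, mem_halfPart]
  obtain ⟨l1, l2⟩ := length_bressoud_oddPart hs
  rw [imagePairs_eq hs, (leTwo_insertAll (halfList_pairwise s) hb hP).1, h2, List.forall_mem_map,
    length_halfList]
  refine forall₂_congr fun k _ => ?_
  -- Twice the number of pairs is known only up to `1`, but it is compared with the even number `2k
  -- + 2`.
  omega

theorem oddToDistinct_mem_distinctLeTwo {n : ℕ} {l : n.Partition}
    (h : l ∈ Nat.Partition.odds n) :
    oddToDistinct l ∈ distinctLeTwo n ↔ l ∈ oddDistinctSmall n := by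
  obtain ⟨⟨b, hb⟩, h1, h2⟩ := pairsOf_oddToDistinct h
  have hlt : ∀ {b : ℕ} {L : List (ℕ × ℕ)}, Below b L → ∀ q ∈ L, q.2 < q.1 := by
    intro b L hL
    induction L generalizing b with
    | nil => simp
    | cons q L ih => exact List.forall_mem_cons.mpr ⟨hL.2.1, ih hL.2.2⟩
  rw [mem_distinctLeTwo, mem_oddDistinctSmall, h2, ← leTwo_imagePairs (mem_odds.mp h), LeTwo]
  simp only [h1, h, true_and]
  refine forall₂_congr fun q hq => ?_
  have := hlt hb q hq
  omega

theorem bijOn_oddDistinctSmall (n : ℕ) :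
    Set.BijOn (oddToDistinct (n := n)) (oddDistinctSmall n) (distinctLeTwo n) := by
  obtain ⟨-, hi, hs⟩ := bijOn_oddToDistinct n
  refine ⟨fun l hl => (oddToDistinct_mem_distinctLeTwo hl.1).mpr hl, hi.mono fun l hl => hl.1, ?_⟩
  intro ν hν
  obtain ⟨l, hl, rfl⟩ := hs hν.1
  exact ⟨l, (oddToDistinct_mem_distinctLeTwo hl).mp hν, rfl⟩

end SpinRegular

theorem mainTheorem3 (n : ℕ) :
    Set.BijOn (SpinRegular.oddToDistinct (n := n))
      {l | l ∈ Nat.Partition.odds n} {ν | ν ∈ Nat.Partition.distincts n} ∧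
    Set.BijOn (SpinRegular.oddToDistinct (n := n))
      (SpinRegular.oddDistinctSmall n) (SpinRegular.distinctLeTwo n) ∧
    Set.BijOn (SpinRegular.double (n := n))
      (SpinRegular.spinRegular n) (SpinRegular.distinctLeTwo n) ∧
    (SpinRegular.spinRegular n).ncard =
      {l : n.Partition | l ∈ Nat.Partition.odds n ∧ ∀ i : ℕ, 2 ≤ l.parts.count i →
        l.parts.card + SpinRegular.oddRuns l.parts ≤ i + 1}.ncard := by
  refine ⟨SpinRegular.bijOn_oddToDistinct n, SpinRegular.bijOn_oddDistinctSmall n,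
    SpinRegular.bijOn_double n, ?_⟩
  have h1 := SpinRegular.bijOn_double n
  have h2 := SpinRegular.bijOn_oddDistinctSmall n
  have h3 : SpinRegular.oddDistinctSmall n = {l : n.Partition | l ∈ Nat.Partition.odds n ∧
      ∀ i : ℕ, 2 ≤ l.parts.count i →
        l.parts.card + SpinRegular.oddRuns l.parts ≤ i + 1} :=
    Set.ext fun _ => SpinRegular.mem_oddDistinctSmall
  rw [← h3, ← h1.injOn.ncard_image, h1.image_eq, ← h2.image_eq,
    h2.injOn.ncard_image]
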